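/- **Setting.** All objects are smooth. A contact path geometry on a contact three-manifold $M$ consists of a five-manifold $P$, a surjective submersion $\rho:P\to M$ and a line field $L$ on $P$ transverse to the (two-dimensional) fibres of $\rho$ such that, with $\mathcal I$ the Pfaffian system annihilating $L$ and the fibres of $\rho$, and $\mathcal J$ the intersection of the retracting space (Cartan system) of $\mathcal I$ with $L^\perp$: (i) $\rho_*$ maps $L$ into the contact planes; (ii) the first derived system $\mathcal I'$ is one-dimensional at each point; (iii) $\mathcal J'=\mathcal I$ at each point. A 0-adapted coframe is a local coframe $(\sigma,\theta_0,\theta_1,\theta_2,\theta_3)$ on $P$ such that $\ker\theta_0$ consists of the vectors projecting into the contact planes, $\mathcal I=\{\theta_0,\theta_1\}$, $\mathcal J=\{\theta_0,\theta_1,\theta_2\}$, $L^\perp=\{\theta_0,\theta_1,\theta_2,\theta_3\}$, and $d\theta_i\equiv\sigma\wedge\theta_{i+1}$ mod $\theta_0,\dots,\theta_i$ for $0\le i\le 2$. Let $G_1\subset GL(5,\mathbb R)$ be the three-dimensional group of the matrices $$g(a,b,c)=\mathrm{diag}(a,\,b,\,a^{-1}b,\,a^{-2}b,\,a^{-3}b)\cdot\exp\bigl(c\,(E_{32}+\tfrac43E_{43}+E_{54})\bigr),\qquad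 a,b\in\mathbb R^*,\ c\in\mathbb R,$$ where $E_{ij}$ are the elementary matrices. Let $B_1\to P$ be the canonical $G_1$-structure of the path geometry: a principal $G_1$-bundle of 0-adapted coframes (with $G_1$ acting on a coframe, written as a column, by $g\cdot(\sigma,\theta_0,\dots,\theta_3)^t$), with its tautological forms $\sigma,\theta_0,\dots,\theta_3$ on $B_1$ and its canonical connection, that is, one-forms $\alpha,\beta,\gamma$ on $B_1$ whose values on the fundamental vector fields of the one-parameter groups $g(e^t,1,0)$, $g(1,e^t,0)$, $g(1,1,t)$ are $(1,0,0)$, $(0,1,0)$, $(0,0,1)$, and functions $I_0,I_1,T_1,\dots,T_8$ on $B_1$, such that $$\begin{aligned} d\sigma&=\alpha\wedge\sigma+\theta_0\wedge(T_1\theta_1+T_2\theta_2+T_3\theta_3)+\theta_1\wedge(T_4\theta_2+T_5\theta_3),\\ d\theta_0&=\beta\wedge\theta_0+\sigma\wedge\theta_1,\\ d\theta_1&=(\beta-\alpha)\wedge\theta_1+\gamma\wedge\theta_0+\sigma\wedge\theta_2,\\ d\theta_2&=(\beta-2\alpha)\wedge\theta_2+\tfrac43\gamma\wedge\theta_1+\sigma\wedge\theta_3,\\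 d\theta_3&=(\beta-3\alpha)\wedge\theta_3+\gamma\wedge\theta_2+\sigma\wedge(I_0\theta_0+I_1\theta_1)+T_6\theta_0\wedge\theta_1+T_7\theta_0\wedge\theta_2+T_8\theta_1\wedge\theta_2 . \end{aligned}$$ **Proposition (refined structure equations).** Suppose that the path geometry is variational, i.e. $I_1=T_5=T_8=0$ identically on $B_1$. Then there exist smooth functions $U_1,U_2$ on $B_1$ such that, with $$\tau=T_1\theta_1+T_2\theta_2+T_3\theta_3,\qquad \nu=U_1\theta_1+U_2\theta_2-T_2\theta_3+T_7\sigma,$$ the connection forms satisfy $$\begin{aligned} d\alpha&=\tfrac23\,d\beta,\\ d\beta&=\sigma\wedge\gamma-\tau\wedge\theta_1-3\nu\wedge\theta_0,\\ d\gamma&\equiv\gamma\wedge\alpha-\tau\wedge\theta_2-\nu\wedge\theta_1\quad\mathrm{mod}\ \theta_0, \end{aligned}$$ the torsion components satisfy $T_3=-\tfrac35T_4$, and $$\begin{aligned} dT_1&\equiv T_1(2\alpha-2\beta)-\tfrac43T_2\gamma-2U_1\sigma&&\mathrm{mod}\ \theta_0,\theta_1,\theta_2,\theta_3,\\ dT_2&\equiv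 T_2(3\alpha-2\beta)-\tfrac25T_4\gamma-(T_1+2U_2)\sigma&&\mathrm{mod}\ \theta_0,\theta_1,\theta_2,\theta_3,\\ dT_4&\equiv T_4(4\alpha-2\beta)-\tfrac53T_2\sigma&&\mathrm{mod}\ \theta_0,\theta_1,\theta_2. \end{aligned}$$ Moreover $T_4$ is a relative invariant, i.e. it varies along the fibres of $B_1$ only by scaling: $T_4(g(a,b,c)\cdot u)=a^4b^{-2}\,T_4(u)$ for all $u\in B_1$ and $g(a,b,c)\in G_1$. -/

import Mathlib

open scoped Manifold ContDiff Topology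

noncomputable section

namespace PathGeom

/-- The Euclidean model space of dimension `n`. -/
abbrev Eu (n : ℕ) : Type := EuclideanSpace ℝ (Fin n)

/-! ### Differential forms on manifolds -/

section Forms

variable {n : ℕ} {X : Type*} [TopologicalSpace X] [ChartedSpace (Eu n) X]

/-- The tangent space of an `n`-manifold at a point. -/
abbrev Tan (n : ℕ) {X : Type*} [TopologicalSpace X] [ChartedSpace (Eu n) X] (x : X) : Type :=
  TangentSpace 𝓘(ℝ, Eu n) x

/-- A (not necessarily smooth) differential one-form on an `n`-manifold. -/
abbrev OneForm (n : ℕ) (X : Type*) [TopologicalSpace X] [ChartedSpace (Eu n) X] : Type _ :=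
  ∀ x : X, Tan n x →L[ℝ] ℝ

/-- The expression of a one-form in a chart `e`, i.e. its pullback by `e.symm`. -/
def OneForm.inChart (ξ : OneForm n X) (e : OpenPartialHomeomorph X (Eu n)) (y : Eu n) :
    Eu n →L[ℝ] ℝ :=
  (ξ (e.symm y)).comp (mfderiv 𝓘(ℝ, Eu n) 𝓘(ℝ, Eu n) e.symm y)

/-- Smoothness of a one-form on a set `U` (used for open `U` only). -/
def OneForm.SmoothOn (ξ : OneForm n X) (U : Set X) : Prop :=
  ∀ e ∈ atlas (Eu n) X, ContDiffOn ℝ ∞ (ξ.inChart e) (e.target ∩ e.symm ⁻¹' U)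

/-- Smoothness of a one-form. -/
def OneForm.Smooth (ξ : OneForm n X) : Prop := ξ.SmoothOn Set.univ

/-- The exterior derivative of a one-form at `x`: the pullback, by the chart at `x`, of the exterior
derivative of the expression of the form in that chart. -/
def OneForm.d (ξ : OneForm n X) (x : X) : Tan n x [⋀^Fin 2]→L[ℝ] ℝ :=
  (extDeriv (fun y => ContinuousAlternatingMap.ofSubsingleton ℝ (Eu n) ℝ (0 : Fin 1)
      (ξ.inChart (chartAt (Eu n) x) y)) (chartAt (Eu n) x x)).compContinuousLinearMap
    (mfderiv 𝓘(ℝ, Eu n) 𝓘(ℝ, Eu n) (chartAt (Eu n) x) x)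

/-- Mathlib's exterior derivative of a one-form in coordinates. -/
theorem extDeriv_oneForm_apply {V : Type*} [NormedAddCommGroup V] [NormedSpace ℝ V] (f : V → V →L[ℝ] ℝ) (x v w : V)
   (hd : DifferentiableAt ℝ f x) :
   extDeriv (fun y => ContinuousAlternatingMap.ofSubsingleton ℝ V ℝ (0 : Fin 1) (f y)) x ![v, w]
    = fderiv ℝ f x v w - fderiv ℝ f x w v := by
  let LL : (V →L[ℝ] ℝ) →L[ℝ] (V [⋀^Fin 1]→L[ℝ] ℝ) :=
    (ContinuousAlternatingMap.ofSubsingletonLIE (𝕜:=ℝ) (E:=V) (F:=ℝ) (0:Fin 1)).toContinuousLinearEquiv.toContinuousLinearMap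
  have hh : HasFDerivAt (fun y => ContinuousAlternatingMap.ofSubsingleton ℝ V ℝ (0 : Fin 1) (f y)) (LL.comp (fderiv ℝ f x)) x :=
    LL.hasFDerivAt.comp x hd.hasFDerivAt
  have hL : ∀ g (u : Fin 1 → V), LL g u = g (u 0) := fun _ _ => rfl
  simp [extDeriv, hh.fderiv, ContinuousAlternatingMap.alternatizeUncurryFin_apply, Fin.sum_univ_two, Fin.removeNth, hL]
  ring

theorem OneForm.d_apply (ξ : OneForm n X) (x : X) (v w : Tan n x)
  (hd : DifferentiableAt ℝ (ξ.inChart (chartAt (Eu n) x)) (chartAt (Eu n) x x)) :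
  ξ.d x ![v, w] = fderiv ℝ (ξ.inChart (chartAt (Eu n) x)) (chartAt (Eu n) x x)
     (mfderiv 𝓘(ℝ, Eu n) 𝓘(ℝ, Eu n) (chartAt (Eu n) x) x v) (mfderiv 𝓘(ℝ, Eu n) 𝓘(ℝ, Eu n) (chartAt (Eu n) x) x w)
   - fderiv ℝ (ξ.inChart (chartAt (Eu n) x)) (chartAt (Eu n) x x)
     (mfderiv 𝓘(ℝ, Eu n) 𝓘(ℝ, Eu n) (chartAt (Eu n) x) x w) (mfderiv 𝓘(ℝ, Eu n) 𝓘(ℝ, Eu n) (chartAt (Eu n) x) x v) := by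
  refine Eq.trans ?_ (extDeriv_oneForm_apply _ _ _ _ hd)
  unfold OneForm.d
  refine (ContinuousAlternatingMap.compContinuousLinearMap_apply _ _ _).trans ?_
  congr 1
  funext i
  fin_cases i <;> rfl

/-- The differential of a real function, as a one-form. -/
def dFun (f : X → ℝ) : OneForm n X := fun x => mfderiv 𝓘(ℝ, Eu n) 𝓘(ℝ, ℝ) f x

/-- The wedge product of two covectors. -/
def wedge {V : Type*} [AddCommGroup V] [Module ℝ V] [TopologicalSpace V] (a b : V →L[ℝ] ℝ) :
    V [⋀^Fin 2]→L[ℝ] ℝ where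
  toFun v := a (v 0) * b (v 1) - a (v 1) * b (v 0)
  map_update_add' := by
    intro _ m i x y
    fin_cases i <;> simp [Function.update] <;> ring
  map_update_smul' := by
    intro _ m i c x
    fin_cases i <;> simp [Function.update] <;> ring
  cont := by fun_prop
  map_eq_zero_of_eq' := by
    intro v i j h hij
    fin_cases i <;> fin_cases j <;> simp_all

theorem wedge_apply {V : Type*} [AddCommGroup V] [Module ℝ V] [TopologicalSpace V]
    (a b : V →L[ℝ] ℝ) (v w : V) : wedge a b ![v, w] = a v * b w - a w * b v := rfl

/-- The annihilator, in the cotangent space, of a set of tangent vectors. -/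
def annih {x : X} (W : Set (Tan n x)) : Submodule ℝ (Tan n x →L[ℝ] ℝ) where
  carrier := {ξ | ∀ v ∈ W, ξ v = 0}
  add_mem' := by
    intro a b ha hb v hv
    simp [ha v hv, hb v hv]
  zero_mem' := by
    intro v _
    simp
  smul_mem' := by
    intro c a ha v hv
    simp [ha v hv]

/-- The tangent vectors annihilated by every covector of a set. -/
def coannih {x : X} (S : Set (Tan n x →L[ℝ] ℝ)) : Submodule ℝ (Tan n x) where
  carrier := {v | ∀ ξ ∈ S, ξ v = 0}
  add_mem' := by
    intro a b ha hb ξ hξ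
    simp [ha ξ hξ, hb ξ hξ]
  zero_mem' := by
    intro ξ _
    simp
  smul_mem' := by
    intro c a ha ξ hξ
    simp [ha ξ hξ]

/-- A Pfaffian system, given by its fibres in the cotangent spaces. -/
abbrev Pfaffian (n : ℕ) (X : Type*) [TopologicalSpace X] [ChartedSpace (Eu n) X] : Type _ :=
  ∀ x : X, Submodule ℝ (Tan n x →L[ℝ] ℝ)

/-- `θ` is a smooth section of the Pfaffian system `S` over an open neighbourhood of `x`. -/
def IsLocalSection (S : Pfaffian n X) (θ : OneForm n X) (x : X) : Prop :=
  ∃ U : Set X, IsOpen U ∧ x ∈ U ∧ θ.SmoothOn U ∧ ∀ q ∈ U, θ q ∈ S q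

/-- The fibre at `x` of the first derived system of `S`: the values at `x` of local sections `θ` of
`S` with `dθ ≡ 0` modulo `S` at `x` (that is, `dθ` vanishes on the vectors annihilated by `S`). -/
def derivedSystem (S : Pfaffian n X) (x : X) : Set (Tan n x →L[ℝ] ℝ) :=
  {ξ | ∃ θ : OneForm n X, IsLocalSection S θ x ∧ θ x = ξ ∧
    ∀ v ∈ coannih (S x : Set (Tan n x →L[ℝ] ℝ)), ∀ w ∈ coannih (S x : Set (Tan n x →L[ℝ] ℝ)),
      θ.d x ![v, w] = 0}

/-- The Cauchy characteristic vectors of `S` at `x`: the vectors `v` annihilated by `S` such that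
`v ⌟ dθ` lies in `S` for all local sections `θ` of `S`. -/
def cauchyChar (S : Pfaffian n X) (x : X) : Set (Tan n x) :=
  {v | v ∈ coannih (S x : Set (Tan n x →L[ℝ] ℝ)) ∧ ∀ θ : OneForm n X, IsLocalSection S θ x →
    ∀ w ∈ coannih (S x : Set (Tan n x →L[ℝ] ℝ)), θ.d x ![v, w] = 0}

/-- The retracting space (Cartan system) of `S`. -/
def retractingSpace (S : Pfaffian n X) : Pfaffian n X := fun x => annih (cauchyChar S x)

/-- A contact distribution on a three-manifold: locally the kernel of a smooth one-form `η`
with `η ∧ dη ≠ 0`, i.e. `η ≠ 0` and `dη` is nondegenerate on the kernel of `η`. -/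
def IsContactDistribution (D : ∀ x : X, Submodule ℝ (Tan n x)) : Prop :=
  ∀ x : X, ∃ U : Set X, IsOpen U ∧ x ∈ U ∧ ∃ η : OneForm n X, η.SmoothOn U ∧
    ∀ q ∈ U, η q ≠ 0 ∧ (∀ v : Tan n q, v ∈ D q ↔ η q v = 0) ∧
      ∀ v ∈ D q, v ≠ 0 → ∃ w ∈ D q, η.d q ![v, w] ≠ 0

/-- A smooth line field. -/
def IsLineField [IsManifold 𝓘(ℝ, Eu n) ∞ X] (L : ∀ x : X, Submodule ℝ (Tan n x)) : Prop :=
  ∀ x : X, ∃ U : Set X, IsOpen U ∧ x ∈ U ∧ ∃ ℓ : ∀ q : X, Tan n q,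
    ContMDiffOn 𝓘(ℝ, Eu n) (𝓘(ℝ, Eu n)).tangent ∞
      (fun q => (⟨q, ℓ q⟩ : TangentBundle 𝓘(ℝ, Eu n) X)) U ∧
    ∀ q ∈ U, ℓ q ≠ 0 ∧ L q = Submodule.span ℝ {ℓ q}

end Forms

/-! ### Contact path geometries -/

/-- The kernel of the differential of a map `ρ : P → M` from a 5-manifold to a 3-manifold. -/
def vert {M P : Type*} [TopologicalSpace M] [ChartedSpace (Eu 3) M]
    [TopologicalSpace P] [ChartedSpace (Eu 5) P] (ρ : P → M) (p : P) : Submodule ℝ (Tan 5 p) :=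
  LinearMap.ker (mfderiv 𝓘(ℝ, Eu 5) 𝓘(ℝ, Eu 3) ρ p).toLinearMap

/-- The Pfaffian system annihilating the line field `L` and the fibres of `ρ`. -/
def systemI {M P : Type*} [TopologicalSpace M] [ChartedSpace (Eu 3) M]
    [TopologicalSpace P] [ChartedSpace (Eu 5) P] (ρ : P → M)
    (L : ∀ p : P, Submodule ℝ (Tan 5 p)) : Pfaffian 5 P :=
  fun p => annih ((L p : Set (Tan 5 p)) ∪ (vert ρ p : Set (Tan 5 p)))

/-- The intersection of the retracting space of `systemI` with the annihilator of `L`. -/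
def systemJ {M P : Type*} [TopologicalSpace M] [ChartedSpace (Eu 3) M]
    [TopologicalSpace P] [ChartedSpace (Eu 5) P] (ρ : P → M)
    (L : ∀ p : P, Submodule ℝ (Tan 5 p)) : Pfaffian 5 P :=
  fun p => retractingSpace (systemI ρ L) p ⊓ annih (L p : Set (Tan 5 p))

/-- A contact path geometry `(P, L, ρ)` on a contact three-manifold `M`. -/
structure ContactPathGeometry (M P : Type*) [TopologicalSpace M] [ChartedSpace (Eu 3) M]
    [TopologicalSpace P] [ChartedSpace (Eu 5) P] [IsManifold 𝓘(ℝ, Eu 5) ∞ P] where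
  /-- the contact distribution of `M` -/
  contact : ∀ m : M, Submodule ℝ (Tan 3 m)
  isContact : IsContactDistribution contact
  /-- the projection, a surjective submersion with two-dimensional fibres -/
  ρ : P → M
  smooth_ρ : ContMDiff 𝓘(ℝ, Eu 5) 𝓘(ℝ, Eu 3) ∞ ρ
  surjective_ρ : Function.Surjective ρ
  submersion_ρ : ∀ p : P, Function.Surjective (mfderiv 𝓘(ℝ, Eu 5) 𝓘(ℝ, Eu 3) ρ p)
  /-- the line field -/
  L : ∀ p : P, Submodule ℝ (Tan 5 p)
  isLineField : IsLineField L
  transverse : ∀ p : P, Disjoint (L p) (vert ρ p)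
  tangent_contact : ∀ p : P, ∀ v ∈ L p, mfderiv 𝓘(ℝ, Eu 5) 𝓘(ℝ, Eu 3) ρ p v ∈ contact (ρ p)
  derived_I : ∀ p : P, ∃ ξ : Tan 5 p →L[ℝ] ℝ, ξ ≠ 0 ∧
    derivedSystem (systemI ρ L) p = (Submodule.span ℝ {ξ} : Submodule ℝ (Tan 5 p →L[ℝ] ℝ))
  derived_J : ∀ p : P, derivedSystem (systemJ ρ L) p = systemI ρ L p

section Adapted

variable {M P : Type*} [TopologicalSpace M] [ChartedSpace (Eu 3) M]
  [TopologicalSpace P] [ChartedSpace (Eu 5) P] [IsManifold 𝓘(ℝ, Eu 5) ∞ P]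

/-- The coframing `φ = (σ, θ₀, θ₁, θ₂, θ₃)` is 0-adapted to the contact path geometry `Γ` over the
open set `U`.  Here `φ 0 = σ` and `φ (i + 1) = θᵢ`. -/
structure IsZeroAdaptedOn (Γ : ContactPathGeometry M P) (φ : Fin 5 → OneForm 5 P) (U : Set P) :
    Prop where
  smooth : ∀ i, (φ i).SmoothOn U
  coframe : ∀ q ∈ U, LinearIndependent ℝ (fun i => φ i q)
  contact : ∀ q ∈ U, ∀ v : Tan 5 q,
    mfderiv 𝓘(ℝ, Eu 5) 𝓘(ℝ, Eu 3) Γ.ρ q v ∈ Γ.contact (Γ.ρ q) ↔ φ 1 q v = 0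
  span_I : ∀ q ∈ U, systemI Γ.ρ Γ.L q = Submodule.span ℝ {φ 1 q, φ 2 q}
  span_J : ∀ q ∈ U, systemJ Γ.ρ Γ.L q = Submodule.span ℝ {φ 1 q, φ 2 q, φ 3 q}
  span_L : ∀ q ∈ U, annih (Γ.L q : Set (Tan 5 q)) =
    Submodule.span ℝ {φ 1 q, φ 2 q, φ 3 q, φ 4 q}
  /-- `dθ₀ ≡ σ ∧ θ₁` modulo `θ₀` -/
  d_theta0 : ∀ q ∈ U, ∀ v ∈ coannih {φ 1 q}, ∀ w ∈ coannih {φ 1 q},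
    (φ 1).d q ![v, w] = wedge (φ 0 q) (φ 2 q) ![v, w]
  /-- `dθ₁ ≡ σ ∧ θ₂` modulo `θ₀, θ₁` -/
  d_theta1 : ∀ q ∈ U, ∀ v ∈ coannih {φ 1 q, φ 2 q}, ∀ w ∈ coannih {φ 1 q, φ 2 q},
    (φ 2).d q ![v, w] = wedge (φ 0 q) (φ 3 q) ![v, w]
  /-- `dθ₂ ≡ σ ∧ θ₃` modulo `θ₀, θ₁, θ₂` -/
  d_theta2 : ∀ q ∈ U, ∀ v ∈ coannih {φ 1 q, φ 2 q, φ 3 q},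
    ∀ w ∈ coannih {φ 1 q, φ 2 q, φ 3 q},
    (φ 3).d q ![v, w] = wedge (φ 0 q) (φ 4 q) ![v, w]

/-- The bundle of 0-adapted coframes: a coframe `u` at the point `p` is 0-adapted if it is the value
at `p` of a 0-adapted coframing over an open neighbourhood of `p`. -/
def IsZeroAdaptedAt (Γ : ContactPathGeometry M P) (p : P) (u : Fin 5 → (Tan 5 p →L[ℝ] ℝ)) : Prop :=
  ∃ U : Set P, IsOpen U ∧ p ∈ U ∧ ∃ φ : Fin 5 → OneForm 5 P,
    IsZeroAdaptedOn Γ φ U ∧ ∀ i, φ i p = u i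

end Adapted

/-! ### The structure group -/

/-- The nilpotent generator of the structure group. -/
def nilp : Matrix (Fin 5) (Fin 5) ℝ :=
  !![0, 0, 0, 0, 0; 0, 0, 0, 0, 0; 0, 1, 0, 0, 0; 0, 0, 4 / 3, 0, 0; 0, 0, 0, 1, 0]

/-- The matrix `diag(a, b, b/a, b/a², b/a³) * exp (c • nilp)`, with the exponential series written
out: it ends after the cubic term, as `nilp ^ 4 = 0` (see `exp_smul_nilp`). -/
def gMat (a b c : ℝ) : Matrix (Fin 5) (Fin 5) ℝ :=
  Matrix.diagonal ![a, b, b / a, b / a ^ 2, b / a ^ 3] *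
    (1 + c • nilp + (c ^ 2 / 2) • nilp ^ 2 + (c ^ 3 / 6) • nilp ^ 3)

theorem nilp_pow_two : nilp ^ 2 =
    !![0, 0, 0, 0, 0; 0, 0, 0, 0, 0; 0, 0, 0, 0, 0; 0, 4 / 3, 0, 0, 0; 0, 0, 4 / 3, 0, 0] := by
  rw [pow_two, nilp]
  ext i j
  fin_cases i <;> fin_cases j <;> simp [Matrix.mul_apply, Fin.sum_univ_five]

theorem nilp_pow_three : nilp ^ 3 =
    !![0, 0, 0, 0, 0; 0, 0, 0, 0, 0; 0, 0, 0, 0, 0; 0, 0, 0, 0, 0; 0, 4 / 3, 0, 0, 0] := by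
  rw [pow_succ, nilp_pow_two, nilp]
  ext i j
  fin_cases i <;> fin_cases j <;> simp [Matrix.mul_apply, Fin.sum_univ_five]

theorem nilp_pow_four : nilp ^ 4 = 0 := by
  rw [pow_succ, nilp_pow_three, nilp]
  ext i j
  fin_cases i <;> fin_cases j <;> simp [Matrix.mul_apply, Fin.sum_univ_five]

theorem exp_smul_nilp (c : ℝ) : NormedSpace.exp (c • nilp) =
    1 + c • nilp + (c ^ 2 / 2) • nilp ^ 2 + (c ^ 3 / 6) • nilp ^ 3 := by
  rw [NormedSpace.exp_eq_tsum ℝ]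
  simp only [smul_pow, smul_smul]
  rw [tsum_eq_sum (s := Finset.range 4)]
  · simp only [Finset.sum_range_succ, Finset.sum_range_zero, Nat.factorial]
    rw [show c ^ 2 / 2 = 2⁻¹ * c ^ 2 by ring, show c ^ 3 / 6 = 6⁻¹ * c ^ 3 by ring]
    norm_num
  · intro m hm
    have h : 4 ≤ m := by simpa using hm
    rw [pow_eq_zero_of_le h nilp_pow_four, smul_zero]

theorem gMat_eq (a b c : ℝ) : gMat a b c =
    !![a, 0, 0, 0, 0;
       0, b, 0, 0, 0;
       0, b / a * c, b / a, 0, 0;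
       0, b / a ^ 2 * (2 / 3 * c ^ 2), b / a ^ 2 * (4 / 3 * c), b / a ^ 2, 0;
       0, b / a ^ 3 * (2 / 9 * c ^ 3), b / a ^ 3 * (2 / 3 * c ^ 2), b / a ^ 3 * c, b / a ^ 3] := by
  rw [gMat, nilp_pow_two, nilp_pow_three, nilp]
  ext i j
  fin_cases i <;> fin_cases j <;> simp [Matrix.diagonal_mul] <;> ring_nf <;> simp

theorem gMat_one : gMat 1 1 0 = 1 := by
  rw [gMat_eq]
  ext i j
  fin_cases i <;> fin_cases j <;> simp

theorem gMat_mul (a b c a' b' c' : ℝ) (ha : a ≠ 0) (ha' : a' ≠ 0) :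
    gMat a b c * gMat a' b' c' = gMat (a * a') (b * b') (a' * c + c') := by
  simp only [gMat_eq]
  ext i j
  fin_cases i <;> fin_cases j <;> simp [Matrix.mul_apply, Fin.sum_univ_five] <;> field_simp <;>
    ring

/-- The elements of the structure group, as invertible matrices. -/
def gElt (a b : ℝˣ) (c : ℝ) : GL (Fin 5) ℝ where
  val := gMat a b c
  inv := gMat (a⁻¹ : ℝˣ) (b⁻¹ : ℝˣ) (-(a⁻¹ : ℝˣ) * c)
  val_inv := by
    rw [gMat_mul _ _ _ _ _ _ a.ne_zero (a⁻¹).ne_zero, ← gMat_one]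
    congr 1 <;> simp
  inv_val := by
    rw [gMat_mul _ _ _ _ _ _ (a⁻¹).ne_zero a.ne_zero, ← gMat_one]
    congr 1 <;> simp

theorem gElt_mul (a b a' b' : ℝˣ) (c c' : ℝ) :
    gElt a b c * gElt a' b' c' = gElt (a * a') (b * b') (a' * c + c') := by
  apply Units.ext
  simp [gElt, gMat_mul _ _ _ _ _ _ a.ne_zero a'.ne_zero]

theorem gElt_one : gElt 1 1 0 = 1 := by
  apply Units.ext
  simp [gElt, gMat_one]

/-- The three-dimensional structure group `G₁ ⊂ GL(5, ℝ)`. -/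
def G1 : Subgroup (GL (Fin 5) ℝ) where
  carrier := {g | ∃ (a b : ℝˣ) (c : ℝ), g = gElt a b c}
  mul_mem' := by
    rintro _ _ ⟨a, b, c, rfl⟩ ⟨a', b', c', rfl⟩
    exact ⟨_, _, _, gElt_mul a b a' b' c c'⟩
  one_mem' := ⟨1, 1, 0, gElt_one.symm⟩
  inv_mem' := by
    rintro _ ⟨a, b, c, rfl⟩
    refine ⟨a⁻¹, b⁻¹, -(a⁻¹ : ℝˣ) * c, ?_⟩
    apply Units.ext
    rfl

/-- The element `diag(a, b, b/a, b/a², b/a³) * exp (c • nilp)` of the structure group; this is a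
global coordinate system on the Lie group `G₁`. -/
def G1.mk (a b : ℝˣ) (c : ℝ) : G1 := ⟨gElt a b c, a, b, c, rfl⟩

/-- The positive unit `exp t`. -/
def expUnit (t : ℝ) : ℝˣ := Units.mk0 (Real.exp t) (Real.exp_ne_zero t)

/-! ### `G₁`-structures and their canonical connection -/

section GStructure

variable {M P : Type*} [TopologicalSpace M] [ChartedSpace (Eu 3) M]
  [TopologicalSpace P] [ChartedSpace (Eu 5) P] [IsManifold 𝓘(ℝ, Eu 5) ∞ P]

/-- A `G₁`-structure `B ↘ P` consisting of 0-adapted coframes of the contact path geometry `Γ`: a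
principal `G₁`-bundle over `P` whose points `b` are (label, without repetition) 0-adapted coframes
`frame b` at `π b`, on which `G₁` acts by linear combination of the members of the coframe. -/
structure G1Structure (Γ : ContactPathGeometry M P) (B : Type*) [TopologicalSpace B]
    [ChartedSpace (Eu 8) B] [MulAction G1 B] where
  /-- the bundle projection -/
  π : B → P
  smooth_π : ContMDiff 𝓘(ℝ, Eu 8) 𝓘(ℝ, Eu 5) ∞ π
  surjective_π : Function.Surjective π
  submersion_π : ∀ b : B, Function.Surjective (mfderiv 𝓘(ℝ, Eu 8) 𝓘(ℝ, Eu 5) π b)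
  /-- the action of the structure group is smooth and simply transitive on the fibres of `π` -/
  smooth_action : ContMDiff
    (((𝓘(ℝ, ℝ)).prod ((𝓘(ℝ, ℝ)).prod 𝓘(ℝ, ℝ))).prod 𝓘(ℝ, Eu 8)) 𝓘(ℝ, Eu 8) ∞
    (fun x : (ℝˣ × ℝˣ × ℝ) × B => G1.mk x.1.1 x.1.2.1 x.1.2.2 • x.2)
  fibre_iff : ∀ b b' : B, π b = π b' ↔ ∃! g : G1, g • b = b'
  /-- the coframe of `P` at `π b` -/
  frame : ∀ b : B, Fin 5 → (Tan 5 (π b) →L[ℝ] ℝ)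
  zeroAdapted : ∀ b : B, IsZeroAdaptedAt Γ (π b) (frame b)
  /-- the canonical (tautological) forms `(σ, θ₀, θ₁, θ₂, θ₃)` on `B` are smooth -/
  smooth_canonical : ∀ i, OneForm.Smooth (n := 8) (X := B)
    (fun b => (frame b i).comp (mfderiv 𝓘(ℝ, Eu 8) 𝓘(ℝ, Eu 5) π b))
  /-- the coframe at `g • b` is the matrix `g` applied to the coframe at `b`; equivalently (as
  `π (g • b) = π b`) the pullback of the column of canonical forms by `g` is `g` times it -/
  equivariant : ∀ (g : G1) (b : B) (v : Tan 8 b) (i : Fin 5),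
    frame (g • b) i (mfderiv 𝓘(ℝ, Eu 8) 𝓘(ℝ, Eu 5) π (g • b)
        (mfderiv 𝓘(ℝ, Eu 8) 𝓘(ℝ, Eu 8) (fun x : B => g • x) b v)) =
      ∑ j : Fin 5, (g : GL (Fin 5) ℝ).val i j *
        frame b j (mfderiv 𝓘(ℝ, Eu 8) 𝓘(ℝ, Eu 5) π b v)

variable {Γ : ContactPathGeometry M P} {B : Type*} [TopologicalSpace B]
  [ChartedSpace (Eu 8) B] [MulAction G1 B]

/-- The canonical forms on the total space of a `G₁`-structure. -/
def G1Structure.canonical (R : G1Structure Γ B) (i : Fin 5) : OneForm 8 B :=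
  fun b => (R.frame b i).comp (mfderiv 𝓘(ℝ, Eu 8) 𝓘(ℝ, Eu 5) R.π b)

/-- The canonical form `σ`. -/
def G1Structure.σ (R : G1Structure Γ B) : OneForm 8 B := R.canonical 0
/-- The canonical form `θ₀`. -/
def G1Structure.θ₀ (R : G1Structure Γ B) : OneForm 8 B := R.canonical 1
/-- The canonical form `θ₁`. -/
def G1Structure.θ₁ (R : G1Structure Γ B) : OneForm 8 B := R.canonical 2
/-- The canonical form `θ₂`. -/
def G1Structure.θ₂ (R : G1Structure Γ B) : OneForm 8 B := R.canonical 3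
/-- The canonical form `θ₃`. -/
def G1Structure.θ₃ (R : G1Structure Γ B) : OneForm 8 B := R.canonical 4

/-- `ξ` takes the value `r` on the velocity at `t = 0` of the curve `c`. -/
def EvalVelocity (ξ : OneForm 8 B) (c : ℝ → B) (r : ℝ) : Prop :=
  ξ (c 0) (mfderiv 𝓘(ℝ, ℝ) 𝓘(ℝ, Eu 8) c 0 (1 : ℝ)) = r

/-- The canonical connection of a `G₁`-structure: the connection forms `α, β, γ`, which restrict to
the Maurer-Cartan forms on the fibres, and the torsion components, subject to the structure
equations.  These determine all of them from the `G₁`-structure. -/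
structure CanonicalConnection (R : G1Structure Γ B) where
  α : OneForm 8 B
  β : OneForm 8 B
  γ : OneForm 8 B
  smooth_α : α.Smooth
  smooth_β : β.Smooth
  smooth_γ : γ.Smooth
  /-- the values of `(α, β, γ)` on the fundamental vector fields of the action -/
  fundamental_a : ∀ b : B, EvalVelocity α (fun t => G1.mk (expUnit t) 1 0 • b) 1 ∧
    EvalVelocity β (fun t => G1.mk (expUnit t) 1 0 • b) 0 ∧
    EvalVelocity γ (fun t => G1.mk (expUnit t) 1 0 • b) 0
  fundamental_b : ∀ b : B, EvalVelocity α (fun t => G1.mk 1 (expUnit t) 0 • b) 0 ∧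
    EvalVelocity β (fun t => G1.mk 1 (expUnit t) 0 • b) 1 ∧
    EvalVelocity γ (fun t => G1.mk 1 (expUnit t) 0 • b) 0
  fundamental_c : ∀ b : B, EvalVelocity α (fun t => G1.mk 1 1 t • b) 0 ∧
    EvalVelocity β (fun t => G1.mk 1 1 t • b) 0 ∧
    EvalVelocity γ (fun t => G1.mk 1 1 t • b) 1
  /-- the torsion components -/
  I₀ : B → ℝ
  I₁ : B → ℝ
  T₁ : B → ℝ
  T₂ : B → ℝ
  T₃ : B → ℝ
  T₄ : B → ℝ
  T₅ : B → ℝ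
  T₆ : B → ℝ
  T₇ : B → ℝ
  T₈ : B → ℝ
  smooth_torsion : ∀ f ∈ ({I₀, I₁, T₁, T₂, T₃, T₄, T₅, T₆, T₇, T₈} : Set (B → ℝ)),
    ContMDiff 𝓘(ℝ, Eu 8) 𝓘(ℝ, ℝ) ∞ f
  d_σ : ∀ b, R.σ.d b = wedge (α b) (R.σ b) +
    wedge (R.θ₀ b) (T₁ b • R.θ₁ b + T₂ b • R.θ₂ b + T₃ b • R.θ₃ b) +
    wedge (R.θ₁ b) (T₄ b • R.θ₂ b + T₅ b • R.θ₃ b)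
  d_θ₀ : ∀ b, R.θ₀.d b = wedge (β b) (R.θ₀ b) + wedge (R.σ b) (R.θ₁ b)
  d_θ₁ : ∀ b, R.θ₁.d b = wedge (β b - α b) (R.θ₁ b) + wedge (γ b) (R.θ₀ b) +
    wedge (R.σ b) (R.θ₂ b)
  d_θ₂ : ∀ b, R.θ₂.d b = wedge (β b - (2 : ℝ) • α b) (R.θ₂ b) +
    (4 / 3 : ℝ) • wedge (γ b) (R.θ₁ b) + wedge (R.σ b) (R.θ₃ b)
  d_θ₃ : ∀ b, R.θ₃.d b = wedge (β b - (3 : ℝ) • α b) (R.θ₃ b) + wedge (γ b) (R.θ₂ b) +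
    wedge (R.σ b) (I₀ b • R.θ₀ b + I₁ b • R.θ₁ b) +
    T₆ b • wedge (R.θ₀ b) (R.θ₁ b) + T₇ b • wedge (R.θ₀ b) (R.θ₂ b) +
    T₈ b • wedge (R.θ₁ b) (R.θ₂ b)

/-- The path geometry is variational: `I₁`, `T₅` and `T₈` vanish identically. -/
def CanonicalConnection.IsVariational {R : G1Structure Γ B} (C : CanonicalConnection R) : Prop :=
  ∀ b : B, C.I₁ b = 0 ∧ C.T₅ b = 0 ∧ C.T₈ b = 0

/-- The one-form `τ = T₁ θ₁ + T₂ θ₂ + T₃ θ₃`. -/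
def CanonicalConnection.τ {R : G1Structure Γ B} (C : CanonicalConnection R) : OneForm 8 B :=
  fun b => C.T₁ b • R.θ₁ b + C.T₂ b • R.θ₂ b + C.T₃ b • R.θ₃ b

/-- The one-form `ν = U₁ θ₁ + U₂ θ₂ - T₂ θ₃ + T₇ σ`. -/
def CanonicalConnection.ν {R : G1Structure Γ B} (C : CanonicalConnection R) (U₁ U₂ : B → ℝ) :
    OneForm 8 B :=
  fun b => U₁ b • R.θ₁ b + U₂ b • R.θ₂ b - C.T₂ b • R.θ₃ b + C.T₇ b • R.σ b

end GStructure

end PathGeom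

end

/-! The forms σ, θ₀, …, θ₃, α, β, γ are a coframing of the eight-manifold `B`, and nearly everything
follows from d² = 0. In the dual frame, d(dσ) = 0 and d(dθᵢ) = 0 become, at each point, linear
equations for the components of dα, dβ, dγ and of the differentials of the torsion functions.
`BianchiData` records these equations, so its lemmas are linear algebra.

The identity for σ determines dα modulo σ; the one for θ₀ determines dβ modulo θ₀; the one for θ₁
gives dγ modulo θ₀ in terms of dβ - dα. The θ₁ ∧ θ₂ ∧ θ₃ component of d(dθ₂) forces T₃ = -3/5 T₄.
This holds at every point, so it may be differentiated, and the σ-derivative of T₄ follows. The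
outcome is dα - 2/3 dβ = x θ₀ ∧ θ₁ + y θ₀ ∧ θ₂ (`BianchiData.A_sub_B`), where x and y involve first
derivatives of the torsion.

A further differentiation removes x and y: the left side is exact, while dθ₀ contains σ ∧ θ₁ and dθ₁
contains σ ∧ θ₂, so the right side is closed only if y = 0 and then x = 0
(`CanonicalConnection.eq_zero_of_d_eq`). Hence dα = 2/3 dβ, and the known part of dα supplies the
θ₀-components of dβ. The functions U₁, U₂ are the σ-derivatives of T₁, T₂ up to normalization, and
the derivatives of T₁, T₂, T₄ along the fibres are read off d(dσ) = 0.

The scaling law of T₄ is proved for each group element separately, by pulling back dσ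
(`CanonicalConnection.T₄_smul`). As G₁ is disconnected, the infinitesimal formula for dT₄ would not
suffice. -/

noncomputable section

namespace PathGeom

/-! ### Exterior derivatives in a normed space -/

section Coordinates

variable {V W : Type*} [NormedAddCommGroup V] [NormedSpace ℝ V]
  [NormedAddCommGroup W] [NormedSpace ℝ W]

/-- The exterior derivative of a one-form on a normed space, as a function of two vectors. -/
def curl (f : V → V →L[ℝ] ℝ) (y v w : V) : ℝ := fderiv ℝ f y v w - fderiv ℝ f y w v

theorem curl_sub_smul {f g : V → V →L[ℝ] ℝ} {y : V} (hf : DifferentiableAt ℝ f y)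
    (hg : DifferentiableAt ℝ g y) (c : ℝ) (v w : V) :
    curl (fun z => f z - c • g z) y v w = curl f y v w - c * curl g y v w := by
  have h : fderiv ℝ (fun z => f z - c • g z) y = fderiv ℝ f y - c • fderiv ℝ g y :=
    (hf.hasFDerivAt.sub (hg.hasFDerivAt.const_smul c)).fderiv
  unfold curl
  rw [h]
  simp only [_root_.sub_apply, _root_.smul_apply, smul_eq_mul]
  ring

/-- The product rule produces one extra term, containing the second derivative of φ; it is symmetric
in the two vectors and cancels. -/
theorem curl_pullback {f : W → W →L[ℝ] ℝ} {φ : V → W} {y : V}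
    (hf : DifferentiableAt ℝ f (φ y)) (hφ : ContDiffAt ℝ ∞ φ y) (v w : V) :
    curl (fun z => (f (φ z)).comp (fderiv ℝ φ z)) y v w =
      curl f (φ y) (fderiv ℝ φ y v) (fderiv ℝ φ y w) := by
  have h2 : ContDiffAt ℝ 2 φ y := hφ.of_le (WithTop.coe_le_coe.2 le_top)
  have hφ' : DifferentiableAt ℝ (fderiv ℝ φ) y :=
    (h2.fderiv_right (m := 1) (by norm_num)).differentiableAt (by norm_num)
  have hφd : DifferentiableAt ℝ φ y := h2.differentiableAt (by norm_num)
  have hfφ : HasFDerivAt (fun z => f (φ z)) ((fderiv ℝ f (φ y)).comp (fderiv ℝ φ y)) y :=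
    hf.hasFDerivAt.comp y hφd.hasFDerivAt
  have hsymm := h2.isSymmSndFDerivAt (by simp)
  have := (hfφ.clm_comp hφ'.hasFDerivAt).fderiv
  unfold curl
  rw [this]
  simp [hsymm v w]

/-- The exterior derivative of `f • a ∧ b` in terms of those of `f`, `a` and `b`. -/
theorem curl_curl_sum {ι : Type*} [Fintype ι] {X : V → V →L[ℝ] ℝ} {f : ι → V → ℝ}
    {a b : ι → V → V →L[ℝ] ℝ} {y : V} (hX : ContDiffAt ℝ ∞ X y)
    (hf : ∀ k, DifferentiableAt ℝ (f k) y) (ha : ∀ k, DifferentiableAt ℝ (a k) y)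
    (hb : ∀ k, DifferentiableAt ℝ (b k) y)
    (h : ∀ᶠ z in 𝓝 y, ∀ v w, curl X z v w = ∑ k, f k z * (a k z v * b k z w - a k z w * b k z v))
    (u v w : V) :
    ∑ k, (fderiv ℝ (f k) y u * (a k y v * b k y w - a k y w * b k y v)
      - fderiv ℝ (f k) y v * (a k y u * b k y w - a k y w * b k y u)
      + fderiv ℝ (f k) y w * (a k y u * b k y v - a k y v * b k y u)
      + f k y * (curl (a k) y u v * b k y w - curl (a k) y u w * b k y v
          + curl (a k) y v w * b k y u)
      - f k y * (curl (b k) y u v * a k y w - curl (b k) y u w * a k y v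
          + curl (b k) y v w * a k y u)) = 0 := by
  have h2 : ContDiffAt ℝ 2 X y := hX.of_le (WithTop.coe_le_coe.2 le_top)
  have hX' : DifferentiableAt ℝ (fderiv ℝ X) y :=
    (h2.fderiv_right (m := 1) (by norm_num)).differentiableAt (by norm_num)
  have hsymm := h2.isSymmSndFDerivAt (by simp)
  -- The hypothesis `h` holds near `y`, so with `q`, `r` fixed it can be differentiated at `y` in
  -- the direction `p`.
  have key : ∀ p q r : V, fderiv ℝ (fderiv ℝ X) y p q r - fderiv ℝ (fderiv ℝ X) y p r q =
      ∑ k, (fderiv ℝ (f k) y p * (a k y q * b k y r - a k y r * b k y q)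
        + f k y * (fderiv ℝ (a k) y p q * b k y r + a k y q * fderiv ℝ (b k) y p r
          - fderiv ℝ (a k) y p r * b k y q - a k y r * fderiv ℝ (b k) y p q)) := by
    intro p q r
    have e1 : ∀ q r : V, HasFDerivAt (fun z => fderiv ℝ X z q r)
        (((fderiv ℝ (fderiv ℝ X) y).flip q).flip r) y := by
      intro q r
      have := (hX'.hasFDerivAt.clm_apply (hasFDerivAt_const q y)).clm_apply
        (hasFDerivAt_const r y)
      refine this.congr_fderiv ?_
      ext z
      simp
    have e2 : ∀ {g : V → V →L[ℝ] ℝ} (q : V), DifferentiableAt ℝ g y →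
        HasFDerivAt (fun z => g z q) ((fderiv ℝ g y).flip q) y := by
      intro g q hg
      have := hg.hasFDerivAt.clm_apply (hasFDerivAt_const q y)
      refine this.congr_fderiv ?_
      ext z
      simp
    have e3 := (e1 q r).sub (e1 r q)
    have e4 : HasFDerivAt (fun z => ∑ k, f k z * (a k z q * b k z r - a k z r * b k z q)) _ y :=
      HasFDerivAt.fun_sum fun k _ => (hf k).hasFDerivAt.mul
        (((e2 q (ha k)).mul (e2 r (hb k))).sub ((e2 r (ha k)).mul (e2 q (hb k))))
    have e5 := e3.unique (e4.congr_of_eventuallyEq (h.mono fun z hz => hz q r))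
    have := congrArg (fun L : V →L[ℝ] ℝ => L p) e5
    simp only [_root_.sub_apply, ContinuousLinearMap.flip_apply,
      _root_.sum_apply, _root_.add_apply,
      _root_.smul_apply, smul_eq_mul] at this
    rw [this]
    exact Finset.sum_congr rfl fun k _ => by ring
  -- The alternating sum of `key` over the three vectors vanishes on the left by symmetry of second
  -- derivatives; this is d² = 0.
  have s1 := congrArg (fun L : V →L[ℝ] ℝ => L w) (hsymm u v)
  have s2 := congrArg (fun L : V →L[ℝ] ℝ => L v) (hsymm u w)
  have s3 := congrArg (fun L : V →L[ℝ] ℝ => L u) (hsymm v w)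
  have hcyc : fderiv ℝ (fderiv ℝ X) y u v w - fderiv ℝ (fderiv ℝ X) y u w v
      - (fderiv ℝ (fderiv ℝ X) y v u w - fderiv ℝ (fderiv ℝ X) y v w u)
      + (fderiv ℝ (fderiv ℝ X) y w u v - fderiv ℝ (fderiv ℝ X) y w v u) = 0 := by
    linarith
  rw [key u v w, key v u w, key w u v, ← Finset.sum_sub_distrib, ← Finset.sum_add_distrib] at hcyc
  refine (Finset.sum_congr rfl fun k _ => ?_).trans hcyc
  unfold curl
  ring

end Coordinates

/-! ### Naturality of the exterior derivative on manifolds -/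

section Naturality

variable {n : ℕ} {X : Type*} [TopologicalSpace X] [ChartedSpace (Eu n) X]

/-- The pullback of a one-form by a map. -/
def OneForm.pullback (Φ : X → X) (ξ : OneForm n X) : OneForm n X :=
  fun x => (ξ (Φ x)).comp (mfderiv 𝓘(ℝ, Eu n) 𝓘(ℝ, Eu n) Φ x)

theorem OneForm.Smooth.contDiffAt_inChart {ξ : OneForm n X} (hξ : ξ.Smooth)
    {e : OpenPartialHomeomorph X (Eu n)} (he : e ∈ atlas (Eu n) X) {y : Eu n} (hy : y ∈ e.target) :
    ContDiffAt ℝ ∞ (ξ.inChart e) y := by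
  have := hξ e he
  simp only [Set.preimage_univ, Set.inter_univ] at this
  exact this.contDiffAt (e.open_target.mem_nhds hy)

theorem OneForm.d_eq_curl {ξ : OneForm n X} (hξ : ξ.Smooth) (x : X) (v w : Tan n x) :
    ξ.d x ![v, w] = curl (ξ.inChart (chartAt (Eu n) x)) (chartAt (Eu n) x x)
      (mfderiv 𝓘(ℝ, Eu n) 𝓘(ℝ, Eu n) (chartAt (Eu n) x) x v)
      (mfderiv 𝓘(ℝ, Eu n) 𝓘(ℝ, Eu n) (chartAt (Eu n) x) x w) :=
  ξ.d_apply x v w ((hξ.contDiffAt_inChart (chart_mem_atlas _ x)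
    (mem_chart_target _ x)).differentiableAt (by simp))

theorem OneForm.pullback_id (ξ : OneForm n X) : ξ.pullback id = ξ := by
  funext x
  ext v
  simp [OneForm.pullback, mfderiv_id]

variable [IsManifold 𝓘(ℝ, Eu n) ∞ X]

theorem mdifferentiable_atlas {e : OpenPartialHomeomorph X (Eu n)} (he : e ∈ atlas (Eu n) X) :
    e.MDifferentiable 𝓘(ℝ, Eu n) 𝓘(ℝ, Eu n) :=
  haveI : IsManifold 𝓘(ℝ, Eu n) 1 X := .of_le (n := ∞) (WithTop.coe_le_coe.2 le_top)
  mdifferentiable_of_mem_atlas he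

/-- Near `e x` the chart expression of the pulled back form is the pullback, by the coordinate
expression of `Φ`, of that of `ξ`, so `curl_pullback` applies. With `Φ = id` this is independence of
the chart; with the preferred charts it is naturality of d. -/
theorem curl_inChart_pullback {ξ : OneForm n X} (hξ : ξ.Smooth) {Φ : X → X}
    (hΦ : ContMDiff 𝓘(ℝ, Eu n) 𝓘(ℝ, Eu n) ∞ Φ) {e e' : OpenPartialHomeomorph X (Eu n)}
    (he : e ∈ atlas (Eu n) X) (he' : e' ∈ atlas (Eu n) X) {x : X} (hx : x ∈ e.source)
    (hx' : Φ x ∈ e'.source) (v w : Tan n x) :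
    curl ((ξ.pullback Φ).inChart e) (e x)
        (mfderiv 𝓘(ℝ, Eu n) 𝓘(ℝ, Eu n) e x v) (mfderiv 𝓘(ℝ, Eu n) 𝓘(ℝ, Eu n) e x w) =
      curl (ξ.inChart e') (e' (Φ x))
        (mfderiv 𝓘(ℝ, Eu n) 𝓘(ℝ, Eu n) e' (Φ x) (mfderiv 𝓘(ℝ, Eu n) 𝓘(ℝ, Eu n) Φ x v))
        (mfderiv 𝓘(ℝ, Eu n) 𝓘(ℝ, Eu n) e' (Φ x) (mfderiv 𝓘(ℝ, Eu n) 𝓘(ℝ, Eu n) Φ x w)) := by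
  have hed := mdifferentiable_atlas (n := n) he
  have hed' := mdifferentiable_atlas (n := n) he'
  have hem := IsManifold.subset_maximalAtlas (I := 𝓘(ℝ, Eu n)) (n := ∞) he
  have hem' := IsManifold.subset_maximalAtlas (I := 𝓘(ℝ, Eu n)) (n := ∞) he'
  set φ : Eu n → Eu n := fun z => e' (Φ (e.symm z)) with hφ
  have hderiv : ∀ z ∈ e.target, Φ (e.symm z) ∈ e'.source → ∀ u : Eu n,
      fderiv ℝ φ z u = mfderiv 𝓘(ℝ, Eu n) 𝓘(ℝ, Eu n) e' (Φ (e.symm z))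
        (mfderiv 𝓘(ℝ, Eu n) 𝓘(ℝ, Eu n) Φ (e.symm z)
          (mfderiv 𝓘(ℝ, Eu n) 𝓘(ℝ, Eu n) e.symm z u)) := by
    intro z hz hz' u
    have h1 := (hed.mdifferentiableAt_symm hz).hasMFDerivAt
    have h2 := (hΦ.mdifferentiable (by simp) (e.symm z)).hasMFDerivAt
    have h3 := (hed'.mdifferentiableAt hz').hasMFDerivAt
    have := ((h3.comp _ h2).comp z h1).mfderiv
    rw [← mfderiv_eq_fderiv]
    exact congrArg (fun L : Eu n →L[ℝ] Eu n => L u) this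
  have hopen : ∀ᶠ z in 𝓝 (e x), z ∈ e.target ∧ Φ (e.symm z) ∈ e'.source := by
    have h1 : ∀ᶠ z in 𝓝 (e x), z ∈ e.target := e.open_target.mem_nhds (e.map_source hx)
    have h2 : ContinuousAt (fun z => Φ (e.symm z)) (e x) := by
      refine ContinuousAt.comp (hΦ.continuous.continuousAt) ?_
      exact e.symm.continuousAt (e.map_source hx)
    exact h1.and (h2 (e'.open_source.mem_nhds (by simpa [e.left_inv hx] using hx')))
  have hφs : ContDiffAt ℝ ∞ φ (e x) := by
    rw [← contMDiffAt_iff_contDiffAt]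
    have h1 : ContMDiffAt 𝓘(ℝ, Eu n) 𝓘(ℝ, Eu n) ∞ e.symm (e x) :=
      contMDiffAt_symm_of_mem_maximalAtlas hem (e.map_source hx)
    have h3 : ContMDiffAt 𝓘(ℝ, Eu n) 𝓘(ℝ, Eu n) ∞ e' (Φ (e.symm (e x))) :=
      contMDiffAt_of_mem_maximalAtlas hem' (by rwa [e.left_inv hx])
    exact h3.comp (e x) ((hΦ _).comp (e x) h1)
  have heq : (ξ.pullback Φ).inChart e =ᶠ[𝓝 (e x)]
      fun z => (ξ.inChart e' (φ z)).comp (fderiv ℝ φ z) := by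
    filter_upwards [hopen] with z hz
    ext u
    have h1 : (ξ (e'.symm (φ z)) : Eu n →L[ℝ] ℝ) = ξ (Φ (e.symm z)) :=
      congrArg (fun q => (show Eu n →L[ℝ] ℝ from ξ q)) (e'.left_inv hz.2)
    have h2 := hed'.symm_comp_deriv hz.2
    change ξ (Φ (e.symm z)) (mfderiv 𝓘(ℝ, Eu n) 𝓘(ℝ, Eu n) Φ (e.symm z)
          (mfderiv 𝓘(ℝ, Eu n) 𝓘(ℝ, Eu n) e.symm z u)) =
      (ξ (e'.symm (φ z)) : Eu n →L[ℝ] ℝ)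
        (mfderiv 𝓘(ℝ, Eu n) 𝓘(ℝ, Eu n) e'.symm (φ z) (fderiv ℝ φ z u))
    rw [h1, hderiv z hz.1 hz.2]
    exact congrArg (ξ (Φ (e.symm z))) (congrArg (fun L : Eu n →L[ℝ] Eu n => L
      (mfderiv 𝓘(ℝ, Eu n) 𝓘(ℝ, Eu n) Φ (e.symm z)
          (mfderiv 𝓘(ℝ, Eu n) 𝓘(ℝ, Eu n) e.symm z u))) h2).symm
  have hx2 := e.left_inv hx
  have hφx : φ (e x) = e' (Φ x) := by simp only [hφ, hx2]
  have hξd : DifferentiableAt ℝ (ξ.inChart e') (φ (e x)) := by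
    rw [hφx]
    exact (hξ.contDiffAt_inChart he' (e'.map_source hx')).differentiableAt (by simp)
  have hD : ∀ v : Tan n x, fderiv ℝ φ (e x) (mfderiv 𝓘(ℝ, Eu n) 𝓘(ℝ, Eu n) e x v) =
      mfderiv 𝓘(ℝ, Eu n) 𝓘(ℝ, Eu n) e' (Φ x) (mfderiv 𝓘(ℝ, Eu n) 𝓘(ℝ, Eu n) Φ x v) := by
    intro v
    have h2 := hed.symm_comp_deriv hx
    have h3 := hderiv (e x) (e.map_source hx) (by rwa [hx2])
      (mfderiv 𝓘(ℝ, Eu n) 𝓘(ℝ, Eu n) e x v)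
    rw [h3]
    have h4 : (mfderiv 𝓘(ℝ, Eu n) 𝓘(ℝ, Eu n) e.symm (e x)
        (mfderiv 𝓘(ℝ, Eu n) 𝓘(ℝ, Eu n) e x v) : Eu n) = v :=
      congrArg (fun L : Eu n →L[ℝ] Eu n => L v) h2
    rw [h4]
    exact congrArg (fun q => (show Eu n from mfderiv 𝓘(ℝ, Eu n) 𝓘(ℝ, Eu n) e' (Φ q)
      (mfderiv 𝓘(ℝ, Eu n) 𝓘(ℝ, Eu n) Φ q (show Eu n from v)))) hx2
  have hcurl : ∀ v w, curl ((ξ.pullback Φ).inChart e) (e x) v w =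
      curl (fun z => (ξ.inChart e' (φ z)).comp (fderiv ℝ φ z)) (e x) v w := by
    intro v w
    unfold curl
    rw [heq.fderiv_eq]
  -- The vectors lie in tangent spaces at points that agree only propositionally; stating the
  -- congruence in the model space avoids dependent rewriting.
  have hcongr : ∀ p q r p' q' r' : Eu n, p = p' → q = q' → r = r' →
      curl (ξ.inChart e') p q r = curl (ξ.inChart e') p' q' r' := by
    rintro p q r _ _ _ rfl rfl rfl
    rfl
  exact (hcurl _ _).trans ((curl_pullback hξd hφs _ _).trans
    (hcongr _ _ _ _ _ _ hφx (hD v) (hD w)))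

/-- The exterior derivative can be computed in any chart. -/
theorem OneForm.curl_inChart {ξ : OneForm n X} (hξ : ξ.Smooth)
    {e : OpenPartialHomeomorph X (Eu n)} (he : e ∈ atlas (Eu n) X) {x : X} (hx : x ∈ e.source)
    (v w : Tan n x) :
    curl (ξ.inChart e) (e x) (mfderiv 𝓘(ℝ, Eu n) 𝓘(ℝ, Eu n) e x v)
      (mfderiv 𝓘(ℝ, Eu n) 𝓘(ℝ, Eu n) e x w) = ξ.d x ![v, w] := by
  have h := curl_inChart_pullback hξ (Φ := id) contMDiff_id he (chart_mem_atlas (Eu n) x)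
    hx (mem_chart_source _ x) v w
  rw [ξ.pullback_id, mfderiv_id] at h
  rw [ξ.d_eq_curl hξ]
  exact h

/-- The exterior derivative commutes with pullback. -/
theorem OneForm.d_pullback {ξ : OneForm n X} (hξ : ξ.Smooth) {Φ : X → X}
    (hΦ : ContMDiff 𝓘(ℝ, Eu n) 𝓘(ℝ, Eu n) ∞ Φ) (hξΦ : (ξ.pullback Φ).Smooth) (x : X)
    (v w : Tan n x) :
    (ξ.pullback Φ).d x ![v, w] = ξ.d (Φ x) ![mfderiv 𝓘(ℝ, Eu n) 𝓘(ℝ, Eu n) Φ x v,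
      mfderiv 𝓘(ℝ, Eu n) 𝓘(ℝ, Eu n) Φ x w] := by
  rw [OneForm.d_eq_curl hξΦ, OneForm.d_eq_curl hξ]
  exact curl_inChart_pullback hξ hΦ (chart_mem_atlas _ x) (chart_mem_atlas _ (Φ x))
    (mem_chart_source _ x) (mem_chart_source _ (Φ x)) v w

end Naturality

/-! ### The identity d² = 0 and dual frames on manifolds -/

section Coframes

variable {n : ℕ} {X : Type*} [TopologicalSpace X] [ChartedSpace (Eu n) X]

theorem OneForm.Smooth.sub_smul {ξ η : OneForm n X} (hξ : ξ.Smooth) (hη : η.Smooth) (c : ℝ) :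
    OneForm.Smooth (n := n) (X := X) (fun x => ξ x - c • η x) := fun e he =>
  (hξ e he).sub (contDiffOn_const.smul (hη e he) (f := fun _ => c))

theorem OneForm.d_sub_smul {ξ η : OneForm n X} (hξ : ξ.Smooth) (hη : η.Smooth) (c : ℝ) (x : X)
    (v w : Tan n x) :
    OneForm.d (n := n) (X := X) (fun x => ξ x - c • η x) x ![v, w] =
      ξ.d x ![v, w] - c * η.d x ![v, w] := by
  rw [OneForm.d_eq_curl (hξ.sub_smul hη c), OneForm.d_eq_curl hξ, OneForm.d_eq_curl hη]
  exact curl_sub_smul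
    ((hξ.contDiffAt_inChart (chart_mem_atlas _ x) (mem_chart_target _ x)).differentiableAt
      (by simp))
    ((hη.contDiffAt_inChart (chart_mem_atlas _ x) (mem_chart_target _ x)).differentiableAt
      (by simp)) c _ _

variable [IsManifold 𝓘(ℝ, Eu n) ∞ X]

theorem mfderiv_symm_mfderiv {e : OpenPartialHomeomorph X (Eu n)} (he : e ∈ atlas (Eu n) X) {x : X}
    (hx : x ∈ e.source) (u : Tan n x) :
    (mfderiv 𝓘(ℝ, Eu n) 𝓘(ℝ, Eu n) e.symm (e x)
      (mfderiv 𝓘(ℝ, Eu n) 𝓘(ℝ, Eu n) e x u) : Eu n) = u :=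
  congrArg (fun L : Eu n →L[ℝ] Eu n => L u) ((mdifferentiable_atlas he).symm_comp_deriv hx)

theorem mfderiv_mfderiv_symm {e : OpenPartialHomeomorph X (Eu n)} (he : e ∈ atlas (Eu n) X)
    {z : Eu n} (hz : z ∈ e.target) (u : Eu n) :
    (mfderiv 𝓘(ℝ, Eu n) 𝓘(ℝ, Eu n) e (e.symm z)
      (mfderiv 𝓘(ℝ, Eu n) 𝓘(ℝ, Eu n) e.symm z u) : Eu n) = u :=
  congrArg (fun L : Eu n →L[ℝ] Eu n => L u) ((mdifferentiable_atlas he).comp_symm_deriv hz)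

theorem OneForm.inChart_mfderiv (ξ : OneForm n X) {e : OpenPartialHomeomorph X (Eu n)}
    (he : e ∈ atlas (Eu n) X) {x : X} (hx : x ∈ e.source) (u : Tan n x) :
    ξ.inChart e (e x) (mfderiv 𝓘(ℝ, Eu n) 𝓘(ℝ, Eu n) e x u) = ξ x u := by
  have h1 : (ξ (e.symm (e x)) : Eu n →L[ℝ] ℝ) = ξ x :=
    congrArg (fun q => (show Eu n →L[ℝ] ℝ from ξ q)) (e.left_inv hx)
  change (ξ (e.symm (e x)) : Eu n →L[ℝ] ℝ) (mfderiv 𝓘(ℝ, Eu n) 𝓘(ℝ, Eu n) e.symm (e x)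
      (mfderiv 𝓘(ℝ, Eu n) 𝓘(ℝ, Eu n) e x u)) = _
  rw [h1]
  exact congrArg (ξ x) (mfderiv_symm_mfderiv he hx u)

theorem contDiffAt_comp_symm {f : X → ℝ} (hf : ContMDiff 𝓘(ℝ, Eu n) 𝓘(ℝ, ℝ) ∞ f)
    {e : OpenPartialHomeomorph X (Eu n)} (he : e ∈ atlas (Eu n) X) {z : Eu n} (hz : z ∈ e.target) :
    ContDiffAt ℝ ∞ (fun y => f (e.symm y)) z := by
  rw [← contMDiffAt_iff_contDiffAt]
  exact (hf _).comp z (contMDiffAt_symm_of_mem_maximalAtlas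
    (IsManifold.subset_maximalAtlas (I := 𝓘(ℝ, Eu n)) (n := ∞) he) hz)

theorem fderiv_comp_symm {f : X → ℝ} (hf : ContMDiff 𝓘(ℝ, Eu n) 𝓘(ℝ, ℝ) ∞ f)
    {e : OpenPartialHomeomorph X (Eu n)} (he : e ∈ atlas (Eu n) X) {z : Eu n} (hz : z ∈ e.target)
    (u : Eu n) : fderiv ℝ (fun y => f (e.symm y)) z u =
      dFun f (e.symm z) (mfderiv 𝓘(ℝ, Eu n) 𝓘(ℝ, Eu n) e.symm z u) := by
  have h1 := ((mdifferentiable_atlas he).mdifferentiableAt_symm hz).hasMFDerivAt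
  have h2 := (hf.mdifferentiable (by simp) (e.symm z)).hasMFDerivAt
  rw [← mfderiv_eq_fderiv]
  exact congrArg (fun L : Eu n →L[ℝ] ℝ => L u) (h2.comp z h1).mfderiv

theorem fderiv_comp_symm_mfderiv {f : X → ℝ} (hf : ContMDiff 𝓘(ℝ, Eu n) 𝓘(ℝ, ℝ) ∞ f)
    {e : OpenPartialHomeomorph X (Eu n)} (he : e ∈ atlas (Eu n) X) {x : X} (hx : x ∈ e.source)
    (u : Tan n x) : fderiv ℝ (fun y => f (e.symm y)) (e x)
      (mfderiv 𝓘(ℝ, Eu n) 𝓘(ℝ, Eu n) e x u) = dFun f x u := by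
  refine (fderiv_comp_symm hf he (e.map_source hx) _).trans ?_
  have h1 : (dFun f (e.symm (e x)) : Eu n →L[ℝ] ℝ) = dFun (n := n) f x :=
    congrArg (fun q => (show Eu n →L[ℝ] ℝ from dFun (n := n) f q)) (e.left_inv hx)
  refine (congrArg (fun L : Eu n →L[ℝ] ℝ => L (mfderiv 𝓘(ℝ, Eu n) 𝓘(ℝ, Eu n) e.symm (e x)
      (mfderiv 𝓘(ℝ, Eu n) 𝓘(ℝ, Eu n) e x u))) h1).trans ?_
  exact congrArg (dFun (n := n) f x) (mfderiv_symm_mfderiv he hx u)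

/-- The identity `d(dξ) = 0`, when `dξ` is the sum of the two-forms `f k • a k ∧ b k`. -/
theorem OneForm.d_d_sum {ι : Type*} [Fintype ι] {ξ : OneForm n X} (hξ : ξ.Smooth) {f : ι → X → ℝ}
    {a b : ι → OneForm n X} (hf : ∀ k, ContMDiff 𝓘(ℝ, Eu n) 𝓘(ℝ, ℝ) ∞ (f k))
    (ha : ∀ k, (a k).Smooth) (hb : ∀ k, (b k).Smooth)
    (h : ∀ x v w, ξ.d x ![v, w] = ∑ k, f k x * (a k x v * b k x w - a k x w * b k x v))
    (x : X) (u v w : Tan n x) :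
    ∑ k, (dFun (f k) x u * (a k x v * b k x w - a k x w * b k x v)
      - dFun (f k) x v * (a k x u * b k x w - a k x w * b k x u)
      + dFun (f k) x w * (a k x u * b k x v - a k x v * b k x u)
      + f k x * ((a k).d x ![u, v] * b k x w - (a k).d x ![u, w] * b k x v
          + (a k).d x ![v, w] * b k x u)
      - f k x * ((b k).d x ![u, v] * a k x w - (b k).d x ![u, w] * a k x v
          + (b k).d x ![v, w] * a k x u)) = 0 := by
  set e := chartAt (Eu n) x
  have he : e ∈ atlas (Eu n) X := chart_mem_atlas _ x
  have hx : x ∈ e.source := mem_chart_source _ x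
  have hy : e x ∈ e.target := e.map_source hx
  have key := curl_curl_sum (X := ξ.inChart e) (f := fun k z => f k (e.symm z))
    (a := fun k => (a k).inChart e) (b := fun k => (b k).inChart e) (y := e x)
    (hξ.contDiffAt_inChart he hy)
    (fun k => (contDiffAt_comp_symm (hf k) he hy).differentiableAt (by simp))
    (fun k => ((ha k).contDiffAt_inChart he hy).differentiableAt (by simp))
    (fun k => ((hb k).contDiffAt_inChart he hy).differentiableAt (by simp))
    (by
      filter_upwards [e.open_target.mem_nhds hy] with z hz v w
      have h1 := OneForm.curl_inChart hξ he (e.map_target hz)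
        (mfderiv 𝓘(ℝ, Eu n) 𝓘(ℝ, Eu n) e.symm z v) (mfderiv 𝓘(ℝ, Eu n) 𝓘(ℝ, Eu n) e.symm z w)
      have h2 : curl (ξ.inChart e) z v w = ξ.d (e.symm z)
          ![mfderiv 𝓘(ℝ, Eu n) 𝓘(ℝ, Eu n) e.symm z v,
            mfderiv 𝓘(ℝ, Eu n) 𝓘(ℝ, Eu n) e.symm z w] := by
        refine Eq.trans ?_ h1
        have hcongr : ∀ p q r p' q' r' : Eu n, p = p' → q = q' → r = r' →
            curl (ξ.inChart e) p q r = curl (ξ.inChart e) p' q' r' := by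
          rintro p q r _ _ _ rfl rfl rfl
          rfl
        exact hcongr _ _ _ _ _ _ (e.right_inv hz).symm (mfderiv_mfderiv_symm he hz v).symm
          (mfderiv_mfderiv_symm he hz w).symm
      rw [h2, h]
      rfl)
    (mfderiv 𝓘(ℝ, Eu n) 𝓘(ℝ, Eu n) e x u) (mfderiv 𝓘(ℝ, Eu n) 𝓘(ℝ, Eu n) e x v)
    (mfderiv 𝓘(ℝ, Eu n) 𝓘(ℝ, Eu n) e x w)
  refine Eq.trans (Finset.sum_congr rfl fun k _ => ?_) key
  have hfk := fun p => fderiv_comp_symm_mfderiv (hf k) he hx p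
  have hak := fun p => (a k).inChart_mfderiv he hx p
  have hbk := fun p => (b k).inChart_mfderiv he hx p
  have hda := fun p q => OneForm.curl_inChart (ha k) he hx p q
  have hdb := fun p q => OneForm.curl_inChart (hb k) he hx p q
  rw [← hfk u, ← hfk v, ← hfk w, ← hak u, ← hak v, ← hak w, ← hbk u, ← hbk v, ← hbk w,
    ← hda u v, ← hda u w, ← hda v w, ← hdb u v, ← hdb u w, ← hdb v w, e.left_inv hx]

/-- The components of the differential of a smooth function in the frame dual to a smooth coframe
are smooth. -/
theorem contMDiff_dFun_frame {ϑ : Fin n → OneForm n X} (hω : ∀ i, (ϑ i).Smooth)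
    {E : Fin n → ∀ x : X, Tan n x} (hE : ∀ x i j, ϑ i x (E j x) = if i = j then 1 else 0)
    {f : X → ℝ} (hf : ContMDiff 𝓘(ℝ, Eu n) 𝓘(ℝ, ℝ) ∞ f) (j : Fin n) :
    ContMDiff 𝓘(ℝ, Eu n) 𝓘(ℝ, ℝ) ∞ (fun x => dFun f x (E j x)) := by
  intro x
  set e := chartAt (Eu n) x
  have he : e ∈ atlas (Eu n) X := chart_mem_atlas _ x
  have hx : x ∈ e.source := mem_chart_source _ x
  have hy : e x ∈ e.target := e.map_source hx
  -- The matrix of the coframe in the chart. It sends the chart image of `E k` to the k-th standard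
  -- vector, hence is invertible, and smoothness of inversion makes the dual frame smooth although
  -- nothing is assumed about `E`.
  let A : Eu n → Eu n →L[ℝ] Eu n := fun z =>
    ∑ i, ((ϑ i).inChart e z).smulRight (EuclideanSpace.single i (1 : ℝ))
  have hA : ContDiffAt ℝ ∞ A (e x) := by
    refine ContDiffAt.sum fun i _ => ?_
    exact ((hω i).contDiffAt_inChart he hy).smulRight contDiffAt_const
  have hAv : ∀ z v, A z v = ∑ i, (ϑ i).inChart e z v • EuclideanSpace.single i (1 : ℝ) := by
    intro z v
    simp [A, _root_.sum_apply]
  have hAE : ∀ q ∈ e.source, ∀ k, A (e q) (mfderiv 𝓘(ℝ, Eu n) 𝓘(ℝ, Eu n) e q (E k q)) =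
      EuclideanSpace.single k (1 : ℝ) := by
    intro q hq k
    have : ∀ i, (ϑ i).inChart e (e q) (mfderiv 𝓘(ℝ, Eu n) 𝓘(ℝ, Eu n) e q (E k q)) =
      if i = k then 1 else 0 := fun i => ((ϑ i).inChart_mfderiv he hq _).trans (hE q i k)
    refine (hAv _ _).trans ((Finset.sum_congr rfl fun i _ =>
      congrArg (fun r : ℝ => r • EuclideanSpace.single i (1 : ℝ)) (this i)).trans ?_)
    simp
  have hinv : ∀ q ∈ e.source, ∃ L : Eu n ≃L[ℝ] Eu n, (L : Eu n →L[ℝ] Eu n) = A (e q) := by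
    intro q hq
    have hs : Function.Surjective (A (e q)) := by
      intro v
      obtain ⟨W, hW⟩ : ∃ W : Fin n → Eu n, ∀ k, A (e q) (W k) =
        EuclideanSpace.single k (1 : ℝ) := ⟨_, hAE q hq⟩
      refine ⟨∑ k, v k • W k, ?_⟩
      ext i
      simp [hW, Pi.single_apply]
    have hi : Function.Injective (A (e q)) :=
      (LinearMap.injective_iff_surjective (f := (A (e q)).toLinearMap)).2 hs
    exact ⟨ContinuousLinearEquiv.ofBijective (A (e q)) (LinearMap.ker_eq_bot.2 hi)
      (LinearMap.range_eq_top.2 hs), ContinuousLinearEquiv.coe_ofBijective _ _ _⟩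
  have hEinv : ∀ q ∈ e.source, (mfderiv 𝓘(ℝ, Eu n) 𝓘(ℝ, Eu n) e q (E j q) : Eu n) =
      (A (e q)).inverse (EuclideanSpace.single j (1 : ℝ)) := by
    intro q hq
    obtain ⟨L, hL⟩ := hinv q hq
    rw [← hL, ContinuousLinearMap.inverse_equiv]
    refine ((L.symm_apply_eq).2 ?_).symm
    rw [← hAE q hq j, ← hL]
    rfl
  have hinvs : ContDiffAt ℝ ∞ (fun z => (A z).inverse) (e x) := by
    obtain ⟨L, hL⟩ := hinv x hx
    have := contDiffAt_map_inverse (𝕜 := ℝ) (n := ∞) L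
    rw [hL] at this
    exact this.comp (e x) hA
  let g : Eu n → ℝ := fun z => fderiv ℝ (fun y => f (e.symm y)) z
    ((A z).inverse (EuclideanSpace.single j (1 : ℝ)))
  have hg : ContDiffAt ℝ ∞ g (e x) :=
    ((contDiffAt_comp_symm hf he hy).fderiv_right (m := ∞) (by simp)).clm_apply
      (hinvs.clm_apply contDiffAt_const)
  have hge : ContMDiffAt 𝓘(ℝ, Eu n) 𝓘(ℝ, ℝ) ∞ (fun q => g (e q)) x :=
    hg.contMDiffAt.comp x (contMDiffAt_of_mem_maximalAtlas
      (IsManifold.subset_maximalAtlas (I := 𝓘(ℝ, Eu n)) (n := ∞) he) hx)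
  refine hge.congr_of_eventuallyEq ?_
  filter_upwards [e.open_source.mem_nhds hx] with q hq
  rw [← fderiv_comp_symm_mfderiv hf he hq]
  exact congrArg (fderiv ℝ (fun y => f (e.symm y)) (e q)) (hEinv q hq)

end Coframes

/-! ### Linear algebra of the Bianchi identities at a point -/

section Bianchi

/-- The components of the `m`-th member of a coframe in the dual frame. -/
def cof (m i : Fin 8) : ℝ := if m = i then 1 else 0

/-- The components of the wedge product of two covectors. -/
def wd (a b : Fin 8 → ℝ) (i j : Fin 8) : ℝ := a i * b j - a j * b i

/-- The components of the wedge product of a two-form and a covector. -/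
def wdd (F : Fin 8 → Fin 8 → ℝ) (a : Fin 8 → ℝ) (i j k : Fin 8) : ℝ :=
  F i j * a k - F i k * a j + F j k * a i

theorem cof_ne {m i : Fin 8} (h : i ≠ m) : cof m i = 0 := if_neg h.symm

/-- The components at a point, in the frame dual to `(σ, θ₀, θ₁, θ₂, θ₃, α, β, γ)`, of `dα, dβ, dγ`
and of the differentials of the torsion components, subject to the identities `d(dσ) = 0` and
`d(dθᵢ) = 0`, for a variational path geometry. -/
structure BianchiData where
  A : Fin 8 → Fin 8 → ℝ
  B : Fin 8 → Fin 8 → ℝ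
  G : Fin 8 → Fin 8 → ℝ
  S : Fin 8 → Fin 8 → ℝ
  D₀ : Fin 8 → Fin 8 → ℝ
  D₁ : Fin 8 → Fin 8 → ℝ
  D₂ : Fin 8 → Fin 8 → ℝ
  D₃ : Fin 8 → Fin 8 → ℝ
  I₀ : ℝ
  T₁ : ℝ
  T₂ : ℝ
  T₃ : ℝ
  T₄ : ℝ
  T₆ : ℝ
  T₇ : ℝ
  i₀ : Fin 8 → ℝ
  t₁ : Fin 8 → ℝ
  t₂ : Fin 8 → ℝ
  t₃ : Fin 8 → ℝ
  t₄ : Fin 8 → ℝ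
  t₆ : Fin 8 → ℝ
  t₇ : Fin 8 → ℝ
  A_swap : ∀ i j, A i j = -A j i
  B_swap : ∀ i j, B i j = -B j i
  G_swap : ∀ i j, G i j = -G j i
  S_eq : ∀ i j, S i j = wd (cof 5) (cof 0) i j + T₁ * wd (cof 1) (cof 2) i j +
    T₂ * wd (cof 1) (cof 3) i j + T₃ * wd (cof 1) (cof 4) i j + T₄ * wd (cof 2) (cof 3) i j
  D₀_eq : ∀ i j, D₀ i j = wd (cof 6) (cof 1) i j + wd (cof 0) (cof 2) i j
  D₁_eq : ∀ i j, D₁ i j = wd (cof 6) (cof 2) i j - wd (cof 5) (cof 2) i j +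
    wd (cof 7) (cof 1) i j + wd (cof 0) (cof 3) i j
  D₂_eq : ∀ i j, D₂ i j = wd (cof 6) (cof 3) i j - 2 * wd (cof 5) (cof 3) i j +
    4 / 3 * wd (cof 7) (cof 2) i j + wd (cof 0) (cof 4) i j
  D₃_eq : ∀ i j, D₃ i j = wd (cof 6) (cof 4) i j - 3 * wd (cof 5) (cof 4) i j +
    wd (cof 7) (cof 3) i j + I₀ * wd (cof 0) (cof 1) i j +
    T₆ * wd (cof 1) (cof 2) i j + T₇ * wd (cof 1) (cof 3) i j
  ddσ : ∀ i j k, wdd A (cof 0) i j k - wdd S (cof 5) i j k +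
    (wdd (wd (cof 1) (cof 2)) t₁ i j k + T₁ * (wdd D₀ (cof 2) i j k - wdd D₁ (cof 1) i j k)) +
    (wdd (wd (cof 1) (cof 3)) t₂ i j k + T₂ * (wdd D₀ (cof 3) i j k - wdd D₂ (cof 1) i j k)) +
    (wdd (wd (cof 1) (cof 4)) t₃ i j k + T₃ * (wdd D₀ (cof 4) i j k - wdd D₃ (cof 1) i j k)) +
    (wdd (wd (cof 2) (cof 3)) t₄ i j k + T₄ * (wdd D₁ (cof 3) i j k - wdd D₂ (cof 2) i j k)) = 0
  ddθ₀ : ∀ i j k, wdd B (cof 1) i j k - wdd D₀ (cof 6) i j k +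
    (wdd S (cof 2) i j k - wdd D₁ (cof 0) i j k) = 0
  ddθ₁ : ∀ i j k, wdd B (cof 2) i j k - wdd D₁ (cof 6) i j k -
    (wdd A (cof 2) i j k - wdd D₁ (cof 5) i j k) +
    (wdd G (cof 1) i j k - wdd D₀ (cof 7) i j k) +
    (wdd S (cof 3) i j k - wdd D₂ (cof 0) i j k) = 0
  ddθ₂ : ∀ i j k, wdd B (cof 3) i j k - wdd D₂ (cof 6) i j k -
    2 * (wdd A (cof 3) i j k - wdd D₂ (cof 5) i j k) +
    4 / 3 * (wdd G (cof 2) i j k - wdd D₁ (cof 7) i j k) +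
    (wdd S (cof 4) i j k - wdd D₃ (cof 0) i j k) = 0
  ddθ₃ : ∀ i j k, wdd B (cof 4) i j k - wdd D₃ (cof 6) i j k -
    3 * (wdd A (cof 4) i j k - wdd D₃ (cof 5) i j k) +
    (wdd G (cof 3) i j k - wdd D₂ (cof 7) i j k) +
    (wdd (wd (cof 0) (cof 1)) i₀ i j k + I₀ * (wdd S (cof 1) i j k - wdd D₀ (cof 0) i j k)) +
    (wdd (wd (cof 1) (cof 2)) t₆ i j k + T₆ * (wdd D₀ (cof 2) i j k - wdd D₁ (cof 1) i j k)) +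
    (wdd (wd (cof 1) (cof 3)) t₇ i j k + T₇ * (wdd D₀ (cof 3) i j k - wdd D₂ (cof 1) i j k)) = 0

namespace BianchiData

variable (Q : BianchiData)

/-- In d(dσ), the form dα occurs only as dα ∧ σ, so inserting the vector dual to σ isolates it
modulo σ. -/
theorem A_eq (i j : Fin 8) (hi : i ≠ 0) (hj : j ≠ 0) : Q.A i j = -(Q.t₁ 0 * wd (cof 1) (cof 2) i j
    + (Q.T₁ + Q.t₂ 0) * wd (cof 1) (cof 3) i j + (Q.T₂ + Q.t₃ 0) * wd (cof 1) (cof 4) i j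
    + (Q.T₂ + Q.t₄ 0) * wd (cof 2) (cof 3) i j
    + (Q.T₃ + Q.T₄) * wd (cof 2) (cof 4) i j) := by
  have c : ∀ m, cof m 0 = if m = 0 then 1 else 0 := fun _ => rfl
  have h := Q.ddσ 0 i j
  simp only [wdd, wd, Q.S_eq, Q.D₀_eq, Q.D₁_eq, Q.D₂_eq, Q.D₃_eq] at h ⊢
  simp [c, cof_ne hi, cof_ne hj] at h ⊢
  linear_combination h

/-- Likewise dβ occurs in d(dθ₀) only as dβ ∧ θ₀; the vector dual to θ₀ is inserted. -/
theorem B_eq (i j : Fin 8) (hi : i ≠ 1) (hj : j ≠ 1) : Q.B i j = wd (cof 0) (cof 7) i j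
    - Q.T₂ * wd (cof 3) (cof 2) i j - Q.T₃ * wd (cof 4) (cof 2) i j := by
  have c : ∀ m, cof m 1 = if m = 1 then 1 else 0 := fun _ => rfl
  have h := Q.ddθ₀ i j 1
  simp only [wdd, wd, Q.S_eq, Q.D₀_eq, Q.D₁_eq] at h ⊢
  simp [c, cof_ne hi, cof_ne hj] at h ⊢
  linear_combination h

/-- Here d(dθ₁) contains dγ ∧ θ₀ + (dβ - dα) ∧ θ₁. The second term leaves the still unknown
θ₀-components of dβ - dα, multiplied by θ₁. -/
theorem G_eq (i j : Fin 8) (hi : i ≠ 1) (hj : j ≠ 1) : Q.G i j = wd (cof 7) (cof 5) i j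
    - Q.T₁ * wd (cof 2) (cof 3) i j - Q.T₃ * wd (cof 4) (cof 3) i j
    + (Q.B i 1 - Q.A i 1) * cof 2 j - (Q.B j 1 - Q.A j 1) * cof 2 i := by
  have c : ∀ m, cof m 1 = if m = 1 then 1 else 0 := fun _ => rfl
  have h := Q.ddθ₁ i j 1
  simp only [wdd, wd, Q.S_eq, Q.D₀_eq, Q.D₁_eq, Q.D₂_eq] at h ⊢
  simp [c, cof_ne hi, cof_ne hj] at h ⊢
  linear_combination h

/-- In the θ₁ ∧ θ₂ ∧ θ₃ component of d(dθ₂) the entries of dα, dβ, dγ are already known: T₃, T₄ are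
all that remain, as -T₃ - 2(T₃ + T₄) + 4/3 T₃ + T₄ = 0. -/
theorem T₃_eq : Q.T₃ = -(3 / 5) * Q.T₄ := by
  have h1 := Q.B_eq 2 4 (by decide) (by decide)
  have h2 := Q.A_eq 2 4 (by decide) (by decide)
  have h3 := Q.G_eq 3 4 (by decide) (by decide)
  have h4 := Q.ddθ₂ 2 3 4
  simp [wdd, wd, cof, Q.S_eq, Q.D₁_eq, Q.D₂_eq, Q.D₃_eq] at h1 h2 h3 h4
  linarith

theorem A_one_four : Q.A 1 4 = -(Q.T₂ + Q.t₃ 0) ∧ Q.B 1 4 = 2 * Q.A 1 4 + Q.T₂ := by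
  have h1 := Q.A_eq 1 4 (by decide) (by decide)
  have h2 := Q.ddθ₂ 1 3 4
  simp [wdd, wd, cof, Q.S_eq, Q.D₁_eq, Q.D₂_eq, Q.D₃_eq] at h1 h2
  constructor <;> linarith

/-- The hypothesis is the derivative of `T₃_eq`; it is extra input, since the data live at a single
point. The θ₁, θ₃ entry of dγ is then computed twice, from d(dθ₁) and from d(dθ₃). -/
theorem t₄_σ (h : ∀ i, Q.t₃ i = -(3 / 5) * Q.t₄ i) : Q.t₄ 0 = -(5 / 3) * Q.T₂ := by
  obtain ⟨h1, h2⟩ := Q.A_one_four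
  have h3 := Q.ddθ₁ 1 2 4
  have h4 := Q.ddθ₃ 2 3 4
  have h5 := Q.A_eq 2 3 (by decide) (by decide)
  have h6 := Q.B_eq 2 3 (by decide) (by decide)
  simp [wdd, wd, cof, Q.S_eq, Q.D₀_eq, Q.D₁_eq, Q.D₂_eq, Q.D₃_eq] at h3 h4 h5 h6
  linarith [h 0]

/-- In d(dσ), the components along θ₀ ∧ θ₁ and one connection form involve no other derivative of
the torsion. The next two lemmas use θ₀ ∧ θ₂ and θ₁ ∧ θ₂ in the same way. -/
theorem t₁_vertical : Q.t₁ 5 = 2 * Q.T₁ ∧ Q.t₁ 6 = -2 * Q.T₁ ∧ Q.t₁ 7 = -(4 / 3) * Q.T₂ := by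
  have h1 := Q.ddσ 1 2 5
  have h2 := Q.ddσ 1 2 6
  have h3 := Q.ddσ 1 2 7
  simp [wdd, wd, cof, Q.S_eq, Q.D₀_eq, Q.D₁_eq, Q.D₂_eq, Q.D₃_eq] at h1 h2 h3
  refine ⟨?_, ?_, ?_⟩ <;> linarith [Q.A_eq 1 5, Q.A_eq 2 5]

theorem t₂_vertical : Q.t₂ 5 = 3 * Q.T₂ ∧ Q.t₂ 6 = -2 * Q.T₂ ∧ Q.t₂ 7 = -(2 / 5) * Q.T₄ := by
  have h1 := Q.ddσ 1 3 5
  have h2 := Q.ddσ 1 3 6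
  have h3 := Q.ddσ 1 3 7
  simp [wdd, wd, cof, Q.S_eq, Q.D₀_eq, Q.D₁_eq, Q.D₂_eq, Q.D₃_eq] at h1 h2 h3
  refine ⟨?_, ?_, ?_⟩ <;> linarith [Q.T₃_eq]

/-- The vanishing θ₃-component is what allows dT₄ to be given modulo θ₀, θ₁, θ₂ only. -/
theorem t₄_vertical : Q.t₄ 4 = 0 ∧ Q.t₄ 5 = 4 * Q.T₄ ∧ Q.t₄ 6 = -2 * Q.T₄ ∧ Q.t₄ 7 = 0 := by
  have h0 := Q.ddσ 2 3 4
  have h1 := Q.ddσ 2 3 5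
  have h2 := Q.ddσ 2 3 6
  have h3 := Q.ddσ 2 3 7
  simp [wdd, wd, cof, Q.S_eq, Q.D₀_eq, Q.D₁_eq, Q.D₂_eq, Q.D₃_eq] at h0 h1 h2 h3
  refine ⟨?_, ?_, ?_, ?_⟩ <;> linarith

/-- This is the part of dα that `A_eq` misses. For j = 1 the σ, θ₀ entries of dα and dβ and the σ,
θ₁ entry of dγ solve a system of three equations; for j ≠ 1, d(dθ₁) or d(dθ₂) compares dα with the
known dβ. The 2/3 comes from the coefficient 4/3 in dθ₂. -/
theorem A_σ (j : Fin 8) : Q.A 0 j = -2 * Q.T₇ * cof 1 j + 2 / 3 * cof 7 j := by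
  have hσ := Q.A_swap 0 0
  have h01 := Q.ddθ₁ 0 1 2
  have h01' := Q.ddθ₂ 0 1 3
  have h01'' := Q.ddθ₃ 0 2 3
  have h02 := Q.ddθ₂ 0 2 3
  have h02' := Q.ddθ₁ 0 1 3
  have h03 := Q.ddθ₁ 0 2 3
  have h04 := Q.ddθ₁ 0 2 4
  have h05 := Q.ddθ₁ 0 2 5
  have h06 := Q.ddθ₁ 0 2 6
  have h07 := Q.ddθ₁ 0 2 7
  have b2 := Q.B_eq 0 2 (by decide) (by decide)
  have b3 := Q.B_eq 0 3 (by decide) (by decide)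
  have b4 := Q.B_eq 0 4 (by decide) (by decide)
  have b5 := Q.B_eq 0 5 (by decide) (by decide)
  have b6 := Q.B_eq 0 6 (by decide) (by decide)
  have b7 := Q.B_eq 0 7 (by decide) (by decide)
  simp [wdd, wd, cof, Q.S_eq, Q.D₀_eq, Q.D₁_eq, Q.D₂_eq, Q.D₃_eq] at *
  fin_cases j <;> simp <;> linarith

theorem B_σ_θ₀ : Q.B 0 1 = -3 * Q.T₇ := by
  have h1 := Q.A_σ 1
  have h2 := Q.ddθ₂ 0 1 3
  simp [wdd, wd, cof, Q.S_eq, Q.D₁_eq, Q.D₂_eq, Q.D₃_eq] at h1 h2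
  linarith

theorem B_θ₀ : Q.B 1 2 = 3 * Q.A 1 2 - Q.t₆ 4 ∧
    Q.B 1 3 = 3 * Q.A 1 3 + 3 / 4 * Q.T₁ - Q.t₇ 4 ∧ Q.B 1 5 = 0 ∧ Q.B 1 6 = 0 ∧ Q.B 1 7 = 0 := by
  have h2 := Q.ddθ₃ 1 2 4
  have h3 := Q.ddθ₃ 1 3 4
  have h3' := Q.ddθ₂ 1 2 4
  have h5 := Q.ddθ₂ 1 3 5
  have h6 := Q.ddθ₂ 1 3 6
  have h7 := Q.ddθ₂ 1 3 7
  have a5 := Q.A_eq 1 5 (by decide) (by decide)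
  have a6 := Q.A_eq 1 6 (by decide) (by decide)
  have a7 := Q.A_eq 1 7 (by decide) (by decide)
  simp [wdd, wd, cof, Q.S_eq, Q.D₀_eq, Q.D₁_eq, Q.D₂_eq, Q.D₃_eq] at *
  refine ⟨?_, ?_, ?_, ?_, ?_⟩ <;> linarith

/-- The entries of dα and 2/3 dβ agree wherever both are known; only two θ₀-entries, where d(dθ₃)
brings in derivatives of T₆ and T₇, resist the pointwise identities. -/
theorem A_sub_B (h : ∀ i, Q.t₃ i = -(3 / 5) * Q.t₄ i) (i j : Fin 8) :
    Q.A i j - 2 / 3 * Q.B i j = (Q.t₁ 0 + 2 / 3 * Q.t₆ 4) * wd (cof 1) (cof 2) i j +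
      (Q.T₁ / 2 + Q.t₂ 0 + 2 / 3 * Q.t₇ 4) * wd (cof 1) (cof 3) i j := by
  have hT := Q.T₃_eq
  have ht := Q.t₄_σ h
  have ht3 := h 0
  have key0 : ∀ j, Q.A 0 j - 2 / 3 * Q.B 0 j = 0 := by
    intro j
    rw [Q.A_σ]
    by_cases hj : j = 1
    · rw [hj, Q.B_σ_θ₀]
      simp [cof]
      ring
    · rw [Q.B_eq 0 j (by decide) hj]
      simp [wd, cof, Ne.symm hj]
  have key1 : ∀ j, j ≠ 0 → Q.A 1 j - 2 / 3 * Q.B 1 j =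
      (Q.t₁ 0 + 2 / 3 * Q.t₆ 4) * wd (cof 1) (cof 2) 1 j +
      (Q.T₁ / 2 + Q.t₂ 0 + 2 / 3 * Q.t₇ 4) * wd (cof 1) (cof 3) 1 j := by
    intro j hj
    obtain ⟨b2, b3, b5, b6, b7⟩ := Q.B_θ₀
    have b1 := Q.B_swap 1 1
    have b4 := Q.A_one_four.2
    have a := Q.A_eq 1 j (by decide) hj
    fin_cases j <;> simp [wd, cof] at a hj ⊢ <;> linarith
  -- Away from σ and θ₀ both forms are explicit, and the values of T₃ and of the σ-derivatives of
  -- T₃, T₄ make them proportional.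
  have key2 : ∀ i j, i ≠ 0 → i ≠ 1 → j ≠ 0 → j ≠ 1 → Q.A i j - 2 / 3 * Q.B i j = 0 := by
    intro i j hi hi' hj hj'
    rw [Q.A_eq i j hi hj, Q.B_eq i j hi' hj', hT, ht3, ht]
    simp only [wd, cof_ne hi, cof_ne hj, cof_ne hi', cof_ne hj']
    ring
  have w : ∀ a b i j, wd a b i j = - wd a b j i := fun a b i j => by unfold wd; ring
  by_cases hi : i = 0
  · rw [hi, key0]
    simp [wd, cof]
  by_cases hj : j = 0
  · rw [hj, Q.A_swap, Q.B_swap]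
    have := key0 i
    simp [wd, cof]
    linarith
  by_cases hi' : i = 1
  · rw [hi', key1 j hj]
  by_cases hj' : j = 1
  · rw [hj', Q.A_swap, Q.B_swap, w _ _ i, w _ _ i]
    linarith [key1 i hi]
  rw [key2 i j hi hi' hj hj']
  simp only [wd, cof_ne hi', cof_ne hj']
  ring

/-- Once dα = 2/3 dβ, the θ₀-row of dβ is 3/2 times that of `A_eq`. This explains the factor 3
before ν, and the coefficient -T₂ of θ₃ in ν. -/
theorem B_formula
    (h : ∀ i, Q.t₃ i = -(3 / 5) * Q.t₄ i) (hA : ∀ i j, Q.A i j = 2 / 3 * Q.B i j)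
    {U₁ U₂ : ℝ} (hU₁ : Q.t₁ 0 = -2 * U₁) (hU₂ : Q.t₂ 0 = -(Q.T₁ + 2 * U₂))
    (i j : Fin 8) :
    Q.B i j = wd (cof 0) (cof 7) i j -
    (Q.T₁ * wd (cof 2) (cof 2) i j + Q.T₂ * wd (cof 3) (cof 2) i j +
      Q.T₃ * wd (cof 4) (cof 2) i j) -
    3 * (U₁ * wd (cof 2) (cof 1) i j + U₂ * wd (cof 3) (cof 1) i j -
      Q.T₂ * wd (cof 4) (cof 1) i j + Q.T₇ * wd (cof 0) (cof 1) i j) := by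
  have w : ∀ a b i j, wd a b i j = - wd a b j i := fun a b i j => by unfold wd; ring
  have key1 : ∀ j, j ≠ 0 → Q.B 1 j = wd (cof 0) (cof 7) 1 j -
    (Q.T₁ * wd (cof 2) (cof 2) 1 j + Q.T₂ * wd (cof 3) (cof 2) 1 j +
      Q.T₃ * wd (cof 4) (cof 2) 1 j) -
    3 * (U₁ * wd (cof 2) (cof 1) 1 j + U₂ * wd (cof 3) (cof 1) 1 j -
      Q.T₂ * wd (cof 4) (cof 1) 1 j + Q.T₇ * wd (cof 0) (cof 1) 1 j) := by
    intro j hj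
    have a := Q.A_eq 1 j (by decide) hj
    have b := hA 1 j
    have ht := Q.t₄_σ h
    have ht3 := h 0
    have b1 := Q.B_swap 1 1
    fin_cases j <;> simp [wd, cof] at a b hj ⊢ <;> linarith
  by_cases hi : i = 1
  · by_cases hj : j = 0
    · rw [hi, hj, Q.B_swap, Q.B_σ_θ₀]
      simp [wd, cof]
    · rw [hi, key1 j hj]
  by_cases hj : j = 1
  · by_cases hi' : i = 0
    · rw [hi', hj, Q.B_σ_θ₀]
      simp [wd, cof]
    · rw [hj, Q.B_swap, key1 i hi']
      unfold wd
      ring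
  rw [Q.B_eq i j hi hj]
  simp only [wd, cof_ne hi, cof_ne hj]
  ring

/-- In `G_eq` the unknown dβ - dα is now 1/3 dβ, which turns 3ν into ν. The last summand absorbs the
undetermined θ₀-row of dγ. -/
theorem G_formula
    (h : ∀ i, Q.t₃ i = -(3 / 5) * Q.t₄ i) (hA : ∀ i j, Q.A i j = 2 / 3 * Q.B i j)
    {U₁ U₂ : ℝ} (hU₁ : Q.t₁ 0 = -2 * U₁) (hU₂ : Q.t₂ 0 = -(Q.T₁ + 2 * U₂))
    (i j : Fin 8) :
    Q.G i j = wd (cof 7) (cof 5) i j -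
    (Q.T₁ * wd (cof 2) (cof 3) i j + Q.T₂ * wd (cof 3) (cof 3) i j +
      Q.T₃ * wd (cof 4) (cof 3) i j) -
    (U₁ * wd (cof 2) (cof 2) i j + U₂ * wd (cof 3) (cof 2) i j -
      Q.T₂ * wd (cof 4) (cof 2) i j + Q.T₇ * wd (cof 0) (cof 2) i j) +
    wd (fun k => wd (cof 7) (cof 5) 1 k - Q.G 1 k) (cof 1) i j := by
  have key1 : ∀ j, Q.G 1 j = wd (cof 7) (cof 5) 1 j -
    (Q.T₁ * wd (cof 2) (cof 3) 1 j + Q.T₂ * wd (cof 3) (cof 3) 1 j +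
      Q.T₃ * wd (cof 4) (cof 3) 1 j) -
    (U₁ * wd (cof 2) (cof 2) 1 j + U₂ * wd (cof 3) (cof 2) 1 j -
      Q.T₂ * wd (cof 4) (cof 2) 1 j + Q.T₇ * wd (cof 0) (cof 2) 1 j) +
    wd (fun k => wd (cof 7) (cof 5) 1 k - Q.G 1 k) (cof 1) 1 j := by
    intro j
    by_cases hj : j = 1
    · have := Q.G_swap 1 1
      simp [wd, cof, hj]
      linarith
    · simp [wd, cof, Ne.symm hj]
  by_cases hi : i = 1
  · rw [hi, ← key1 j]
  by_cases hj : j = 1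
  · rw [hj, Q.G_swap, key1 i]
    unfold wd
    ring
  rw [Q.G_eq i j hi hj, hA, hA, Q.B_formula h hA hU₁ hU₂ i, Q.B_formula h hA hU₁ hU₂ j]
  have c : ∀ m, cof m 1 = if m = 1 then 1 else 0 := fun _ => rfl
  simp [wd, cof_ne hi, cof_ne hj, c]
  ring

end BianchiData
end Bianchi

/-! ### The dual frame on the total space -/

theorem exists_dual_vectors {n : ℕ} {ϑ : Fin n → (Eu n →L[ℝ] ℝ)} (h : LinearIndependent ℝ ϑ) :
    ∃ f : Fin n → Eu n, ∀ i j, ϑ i (f j) = if i = j then 1 else 0 := by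
  let ψ : Fin n → Module.Dual ℝ (Eu n) := fun i => (ϑ i).toLinearMap
  have hψ : LinearIndependent ℝ ψ :=
    h.map' (ContinuousLinearMap.coeLM ℝ) (LinearMap.ker_eq_bot.2 ContinuousLinearMap.coe_injective)
  rcases Nat.eq_zero_or_pos n with rfl | hn
  · exact ⟨fun _ => 0, fun i => i.elim0⟩
  have : Nonempty (Fin n) := ⟨⟨0, hn⟩⟩
  let B := basisOfLinearIndependentOfCardEqFinrank hψ (by simp [Subspace.dual_finrank_eq])
  refine ⟨fun j => (Module.evalEquiv ℝ (Eu n)).symm (B.dualBasis j), fun i j => ?_⟩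
  have h1 := Module.apply_evalEquiv_symm_apply ℝ (Eu n) (ψ i) (B.dualBasis j)
  refine h1.trans ?_
  have h2 : ψ i = B i := by simp [B]
  rw [h2, Module.Basis.dualBasis_apply_self]

section Frame

variable {M P : Type*} [TopologicalSpace M] [ChartedSpace (Eu 3) M]
  [TopologicalSpace P] [ChartedSpace (Eu 5) P] [IsManifold 𝓘(ℝ, Eu 5) ∞ P]
  {Γ : ContactPathGeometry M P} {B : Type*} [TopologicalSpace B]
  [ChartedSpace (Eu 8) B] [MulAction G1 B]

/-- The fibre condition for the pair `b, b` says that the action is free; hence `g` is the only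
element taking `b` to `g • b`, and the condition applies backwards. -/
theorem G1Structure.π_smul (R : G1Structure Γ B) (g : G1) (b : B) : R.π (g • b) = R.π b := by
  obtain ⟨h, -, hu⟩ := (R.fibre_iff b b).1 rfl
  have hfree : ∀ k : G1, k • b = b → k = 1 := fun k hk =>
    (hu k hk).trans (hu 1 (one_smul G1 b)).symm
  refine ((R.fibre_iff b (g • b)).2 ⟨g, rfl, fun k hk => ?_⟩).symm
  have := hfree (g⁻¹ * k) (by rw [mul_smul, hk, inv_smul_smul])
  exact (inv_mul_eq_one.1 this).symm

theorem G1Structure.exists_velocity (R : G1Structure Γ B) {b : B} {c : ℝ → B} (h0 : c 0 = b)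
    (hc : ∀ t, ∃ g : G1, c t = g • b) : ∃ v : Tan 8 b, (∀ i, R.canonical i b v = 0) ∧
      ∀ (ξ : OneForm 8 B) (r : ℝ), EvalVelocity ξ c r → ξ b v = r := by
  subst h0
  refine ⟨mfderiv 𝓘(ℝ, ℝ) 𝓘(ℝ, Eu 8) c 0 (1 : ℝ), fun i => ?_, fun ξ r h => h⟩
  have hv : mfderiv 𝓘(ℝ, Eu 8) 𝓘(ℝ, Eu 5) R.π (c 0)
      (mfderiv 𝓘(ℝ, ℝ) 𝓘(ℝ, Eu 8) c 0 (1 : ℝ)) = 0 := by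
    by_cases hd : MDifferentiableAt 𝓘(ℝ, ℝ) 𝓘(ℝ, Eu 8) c 0
    · have h1 := (R.smooth_π.mdifferentiable (by simp) (c 0)).hasMFDerivAt.comp 0 hd.hasMFDerivAt
      have h2 : R.π ∘ c = fun _ => R.π (c 0) := by
        funext t
        obtain ⟨g, hg⟩ := hc t
        simp only [Function.comp, hg, R.π_smul]
      rw [h2] at h1
      have h3 := hasMFDerivAt_unique h1 (hasMFDerivAt_const (R.π (c 0)) (0 : ℝ))
      exact congrArg (fun L : ℝ →L[ℝ] Eu 5 => L 1) h3
    -- Differentiability of the curve is not needed: otherwise its velocity is 0 by convention.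
    · rw [mfderiv_zero_of_not_mdifferentiableAt hd]
      exact map_zero (mfderiv 𝓘(ℝ, Eu 8) 𝓘(ℝ, Eu 5) R.π (c 0))
  exact (congrArg (R.frame (c 0) i) hv).trans (map_zero _)

/-- The coframing of the total space by the canonical forms and the connection forms. -/
def CanonicalConnection.coframe {R : G1Structure Γ B} (C : CanonicalConnection R) :
    Fin 8 → OneForm 8 B :=
  ![R.σ, R.θ₀, R.θ₁, R.θ₂, R.θ₃, C.α, C.β, C.γ]

theorem CanonicalConnection.smooth_coframe {R : G1Structure Γ B} (C : CanonicalConnection R)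
    (i : Fin 8) : (C.coframe i).Smooth := by
  have h := R.smooth_canonical
  fin_cases i
  exacts [h 0, h 1, h 2, h 3, h 4, C.smooth_α, C.smooth_β, C.smooth_γ]

theorem expUnit_zero : expUnit 0 = 1 := Units.ext Real.exp_zero

theorem G1.mk_one : G1.mk 1 1 0 = 1 := Subtype.ext gElt_one

theorem CanonicalConnection.exists_frame {R : G1Structure Γ B} (C : CanonicalConnection R) :
    ∃ E : Fin 8 → ∀ b : B, Tan 8 b, ∀ b i j, C.coframe i b (E j b) = if i = j then 1 else 0 := by
  suffices h : ∀ b : B, ∃ E : Fin 8 → Tan 8 b,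
      ∀ i j, C.coframe i b (E j) = if i = j then 1 else 0 by
    choose E hE using h
    exact ⟨fun j b => E b j, hE⟩
  intro b
  obtain ⟨va, hva, ha⟩ := R.exists_velocity (c := fun t => G1.mk (expUnit t) 1 0 • b) (b := b)
    (by simp only [expUnit_zero, G1.mk_one, one_smul]) (fun t => ⟨_, rfl⟩)
  obtain ⟨vb, hvb, hb⟩ := R.exists_velocity (c := fun t => G1.mk 1 (expUnit t) 0 • b) (b := b)
    (by simp only [expUnit_zero, G1.mk_one, one_smul]) (fun t => ⟨_, rfl⟩)
  obtain ⟨vc, hvc, hc⟩ := R.exists_velocity (c := fun t => G1.mk 1 1 t • b) (b := b)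
    (by simp only [G1.mk_one, one_smul]) (fun t => ⟨_, rfl⟩)
  obtain ⟨a1, a2, a3⟩ := C.fundamental_a b
  obtain ⟨b1, b2, b3⟩ := C.fundamental_b b
  obtain ⟨c1, c2, c3⟩ := C.fundamental_c b
  replace a1 := ha _ _ a1
  replace a2 := ha _ _ a2
  replace a3 := ha _ _ a3
  replace b1 := hb _ _ b1
  replace b2 := hb _ _ b2
  replace b3 := hb _ _ b3
  replace c1 := hc _ _ c1
  replace c2 := hc _ _ c2
  replace c3 := hc _ _ c3
  obtain ⟨U, -, hU, φ, hφ, hφu⟩ := R.zeroAdapted b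
  have hli : LinearIndependent ℝ (R.frame b) := by
    have := hφ.coframe _ hU
    simpa only [hφu] using this
  obtain ⟨f, hf⟩ := exists_dual_vectors hli
  choose e he using fun j => R.submersion_π b (f j)
  have hcan : ∀ i j, R.canonical i b (e j) = if i = j then 1 else 0 := fun i j =>
    (congrArg (R.frame b i) (he j)).trans (hf i j)
  -- Lifts of the dual vectors on `P`, made horizontal by subtracting vertical vectors; this leaves
  -- the values of the canonical forms unchanged.
  let k : Fin 5 → Tan 8 b := fun j =>
    e j - C.α b (e j) • va - C.β b (e j) • vb - C.γ b (e j) • vc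
  have hk : ∀ i j, R.canonical i b (k j) = if i = j then 1 else 0 := by
    intro i j
    simp only [k, map_sub, map_smul, hva, hvb, hvc, hcan, smul_zero, sub_zero]
  have hkα : ∀ j, C.α b (k j) = 0 := by
    intro j
    simp [k, map_sub, map_smul, a1, b1, c1]
  have hkβ : ∀ j, C.β b (k j) = 0 := by
    intro j
    simp [k, map_sub, map_smul, a2, b2, c2]
  have hkγ : ∀ j, C.γ b (k j) = 0 := by
    intro j
    simp [k, map_sub, map_smul, a3, b3, c3]
  refine ⟨![k 0, k 1, k 2, k 3, k 4, va, vb, vc], fun i j => ?_⟩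
  have h0 := hk 0
  have h1 := hk 1
  have h2 := hk 2
  have h3 := hk 3
  have h4 := hk 4
  fin_cases i <;> fin_cases j <;>
    simp [coframe, G1Structure.σ, G1Structure.θ₀, G1Structure.θ₁, G1Structure.θ₂, G1Structure.θ₃,
      h0, h1, h2, h3, h4, hkα, hkβ, hkγ, hva, hvb, hvc, a1, a2, a3, b1, b2, b3, c1, c2, c3]

end Frame

/-! ### The Bianchi identities on the total space -/

section Main

variable {M P : Type*} [TopologicalSpace M] [ChartedSpace (Eu 3) M]
  [TopologicalSpace P] [ChartedSpace (Eu 5) P] [IsManifold 𝓘(ℝ, Eu 5) ∞ P]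
  {Γ : ContactPathGeometry M P} {B : Type*} [TopologicalSpace B]
  [ChartedSpace (Eu 8) B] [MulAction G1 B]

theorem dFun_const {n : ℕ} {X : Type*} [TopologicalSpace X] [ChartedSpace (Eu n) X] (c : ℝ)
    (x : X) :
    dFun (n := n) (fun _ : X => c) x = 0 :=
  mfderiv_const

theorem OneForm.d_swap {n : ℕ} {X : Type*} [TopologicalSpace X] [ChartedSpace (Eu n) X]
    {ξ : OneForm n X} (hξ : ξ.Smooth) (x : X) (v w : Tan n x) :
    ξ.d x ![v, w] = -ξ.d x ![w, v] := by
  rw [OneForm.d_eq_curl hξ, OneForm.d_eq_curl hξ]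
  unfold curl
  ring

variable {R : G1Structure Γ B} (C : CanonicalConnection R)

section Identities

variable {C} (b : B) (u v w : Tan 8 b)

theorem CanonicalConnection.d_σ_apply (hvar : C.IsVariational) : R.σ.d b ![v, w] =
    wedge (C.α b) (R.σ b) ![v, w] + C.T₁ b * wedge (R.θ₀ b) (R.θ₁ b) ![v, w] +
    C.T₂ b * wedge (R.θ₀ b) (R.θ₂ b) ![v, w] + C.T₃ b * wedge (R.θ₀ b) (R.θ₃ b) ![v, w] +
    C.T₄ b * wedge (R.θ₁ b) (R.θ₂ b) ![v, w] := by
  rw [C.d_σ]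
  simp [wedge_apply, (hvar b).2.1]
  ring

theorem CanonicalConnection.d_θ₀_apply : R.θ₀.d b ![v, w] =
    wedge (C.β b) (R.θ₀ b) ![v, w] + wedge (R.σ b) (R.θ₁ b) ![v, w] := by
  rw [C.d_θ₀]
  simp [wedge_apply]

theorem CanonicalConnection.d_θ₁_apply : R.θ₁.d b ![v, w] =
    wedge (C.β b) (R.θ₁ b) ![v, w] - wedge (C.α b) (R.θ₁ b) ![v, w] +
    wedge (C.γ b) (R.θ₀ b) ![v, w] + wedge (R.σ b) (R.θ₂ b) ![v, w] := by
  rw [C.d_θ₁]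
  simp [wedge_apply]
  ring

theorem CanonicalConnection.d_θ₂_apply : R.θ₂.d b ![v, w] =
    wedge (C.β b) (R.θ₂ b) ![v, w] - 2 * wedge (C.α b) (R.θ₂ b) ![v, w] +
    4 / 3 * wedge (C.γ b) (R.θ₁ b) ![v, w] + wedge (R.σ b) (R.θ₃ b) ![v, w] := by
  rw [C.d_θ₂]
  simp [wedge_apply]
  ring

theorem CanonicalConnection.d_θ₃_apply (hvar : C.IsVariational) : R.θ₃.d b ![v, w] =
    wedge (C.β b) (R.θ₃ b) ![v, w] - 3 * wedge (C.α b) (R.θ₃ b) ![v, w] +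
    wedge (C.γ b) (R.θ₂ b) ![v, w] + C.I₀ b * wedge (R.σ b) (R.θ₀ b) ![v, w] +
    C.T₆ b * wedge (R.θ₀ b) (R.θ₁ b) ![v, w] + C.T₇ b * wedge (R.θ₀ b) (R.θ₂ b) ![v, w] := by
  rw [C.d_θ₃]
  simp [wedge_apply, (hvar b).1, (hvar b).2.2]
  ring

end Identities

variable [IsManifold 𝓘(ℝ, Eu 8) ∞ B]

/-- The first-order data of a variational path geometry at a point of the total space. -/
def CanonicalConnection.bianchiData (hvar : C.IsVariational) {E : Fin 8 → ∀ b : B, Tan 8 b}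
    (hE : ∀ b i j, C.coframe i b (E j b) = if i = j then 1 else 0) (b : B) : BianchiData :=
  have hT : ∀ f, f ∈ ({C.I₀, C.I₁, C.T₁, C.T₂, C.T₃, C.T₄, C.T₅, C.T₆, C.T₇, C.T₈} :
    Set (B → ℝ)) → ContMDiff 𝓘(ℝ, Eu 8) 𝓘(ℝ, ℝ) ∞ f := C.smooth_torsion
  have eσ : ∀ j, R.σ b (E j b) = cof 0 j := hE b 0
  have e0 : ∀ j, R.θ₀ b (E j b) = cof 1 j := hE b 1
  have e1 : ∀ j, R.θ₁ b (E j b) = cof 2 j := hE b 2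
  have e2 : ∀ j, R.θ₂ b (E j b) = cof 3 j := hE b 3
  have e3 : ∀ j, R.θ₃ b (E j b) = cof 4 j := hE b 4
  have eα : ∀ j, C.α b (E j b) = cof 5 j := hE b 5
  have eβ : ∀ j, C.β b (E j b) = cof 6 j := hE b 6
  have eγ : ∀ j, C.γ b (E j b) = cof 7 j := hE b 7
  have sσ : R.σ.Smooth := C.smooth_coframe 0
  have s0 : R.θ₀.Smooth := C.smooth_coframe 1
  have s1 : R.θ₁.Smooth := C.smooth_coframe 2
  have s2 : R.θ₂.Smooth := C.smooth_coframe 3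
  have s3 : R.θ₃.Smooth := C.smooth_coframe 4
  { A := fun i j => C.α.d b ![E i b, E j b]
    B := fun i j => C.β.d b ![E i b, E j b]
    G := fun i j => C.γ.d b ![E i b, E j b]
    S := fun i j => R.σ.d b ![E i b, E j b]
    D₀ := fun i j => R.θ₀.d b ![E i b, E j b]
    D₁ := fun i j => R.θ₁.d b ![E i b, E j b]
    D₂ := fun i j => R.θ₂.d b ![E i b, E j b]
    D₃ := fun i j => R.θ₃.d b ![E i b, E j b]
    I₀ := C.I₀ b
    T₁ := C.T₁ b
    T₂ := C.T₂ b
    T₃ := C.T₃ b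
    T₄ := C.T₄ b
    T₆ := C.T₆ b
    T₇ := C.T₇ b
    i₀ := fun i => dFun C.I₀ b (E i b)
    t₁ := fun i => dFun C.T₁ b (E i b)
    t₂ := fun i => dFun C.T₂ b (E i b)
    t₃ := fun i => dFun C.T₃ b (E i b)
    t₄ := fun i => dFun C.T₄ b (E i b)
    t₆ := fun i => dFun C.T₆ b (E i b)
    t₇ := fun i => dFun C.T₇ b (E i b)
    A_swap := fun i j => OneForm.d_swap C.smooth_α _ _ _
    B_swap := fun i j => OneForm.d_swap C.smooth_β _ _ _
    G_swap := fun i j => OneForm.d_swap C.smooth_γ _ _ _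
    S_eq := fun i j => by
      simp only [C.d_σ_apply b _ _ hvar, wedge_apply, eσ, e0, e1, e2, e3, eα, wd]
    D₀_eq := fun i j => by
      simp only [C.d_θ₀_apply, wedge_apply, eσ, e0, e1, eβ, wd]
    D₁_eq := fun i j => by
      simp only [C.d_θ₁_apply, wedge_apply, eσ, e0, e1, e2, eα, eβ, eγ, wd]
    D₂_eq := fun i j => by
      simp only [C.d_θ₂_apply, wedge_apply, eσ, e1, e2, e3, eα, eβ, eγ, wd]
    D₃_eq := fun i j => by
      simp only [C.d_θ₃_apply b _ _ hvar, wedge_apply, eσ, e0, e1, e2, e3, eα, eβ, eγ, wd]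
    ddσ := fun i j k => by
      have h := OneForm.d_d_sum sσ (f := ![fun _ => 1, C.T₁, C.T₂, C.T₃, C.T₄])
        (a := ![C.α, R.θ₀, R.θ₀, R.θ₀, R.θ₁]) (b := ![R.σ, R.θ₁, R.θ₂, R.θ₃, R.θ₂])
        (by
          intro k
          fin_cases k
          exacts [contMDiff_const, hT _ (by simp), hT _ (by simp), hT _ (by simp), hT _ (by simp)])
        (by intro k; fin_cases k; exacts [C.smooth_α, s0, s0, s0, s1])
        (by intro k; fin_cases k; exacts [sσ, s1, s2, s3, s2])
        (by
          intro x v w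
          rw [C.d_σ_apply x _ _ hvar]
          simp [Fin.sum_univ_five, wedge_apply])
        b (E i b) (E j b) (E k b)
      simp [Fin.sum_univ_five, dFun_const, eσ, e0, e1, e2, e3, eα] at h
      simp only [wdd, wd]
      linear_combination h
    ddθ₀ := fun i j k => by
      have h := OneForm.d_d_sum s0 (f := ![fun _ => 1, fun _ => 1])
        (a := ![C.β, R.σ]) (b := ![R.θ₀, R.θ₁])
        (by intro k; fin_cases k <;> exact contMDiff_const)
        (by intro k; fin_cases k; exacts [C.smooth_β, sσ])
        (by intro k; fin_cases k; exacts [s0, s1])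
        (by
          intro x v w
          rw [C.d_θ₀_apply]
          simp [Fin.sum_univ_two, wedge_apply])
        b (E i b) (E j b) (E k b)
      simp [Fin.sum_univ_two, dFun_const, eσ, e0, e1, eβ] at h
      simp only [wdd]
      linear_combination h
    ddθ₁ := fun i j k => by
      have h := OneForm.d_d_sum s1 (f := ![fun _ => 1, fun _ => -1, fun _ => 1, fun _ => 1])
        (a := ![C.β, C.α, C.γ, R.σ]) (b := ![R.θ₁, R.θ₁, R.θ₀, R.θ₂])
        (by intro k; fin_cases k <;> exact contMDiff_const)
        (by intro k; fin_cases k; exacts [C.smooth_β, C.smooth_α, C.smooth_γ, sσ])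
        (by intro k; fin_cases k; exacts [s1, s1, s0, s2])
        (by
          intro x v w
          rw [C.d_θ₁_apply]
          simp [Fin.sum_univ_four, wedge_apply]
          ring)
        b (E i b) (E j b) (E k b)
      simp [Fin.sum_univ_four, dFun_const, eσ, e0, e1, e2, eα, eβ, eγ] at h
      simp only [wdd]
      linear_combination h
    ddθ₂ := fun i j k => by
      have h := OneForm.d_d_sum s2 (f := ![fun _ => 1, fun _ => -2, fun _ => 4 / 3, fun _ => 1])
        (a := ![C.β, C.α, C.γ, R.σ]) (b := ![R.θ₂, R.θ₂, R.θ₁, R.θ₃])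
        (by intro k; fin_cases k <;> exact contMDiff_const)
        (by intro k; fin_cases k; exacts [C.smooth_β, C.smooth_α, C.smooth_γ, sσ])
        (by intro k; fin_cases k; exacts [s2, s2, s1, s3])
        (by
          intro x v w
          rw [C.d_θ₂_apply]
          simp [Fin.sum_univ_four, wedge_apply]
          ring)
        b (E i b) (E j b) (E k b)
      simp [Fin.sum_univ_four, dFun_const, eσ, e1, e2, e3, eα, eβ, eγ] at h
      simp only [wdd]
      linear_combination h
    ddθ₃ := fun i j k => by
      have h := OneForm.d_d_sum s3
        (f := ![fun _ => 1, fun _ => -3, fun _ => 1, C.I₀, C.T₆, C.T₇])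
        (a := ![C.β, C.α, C.γ, R.σ, R.θ₀, R.θ₀]) (b := ![R.θ₃, R.θ₃, R.θ₂, R.θ₀, R.θ₁, R.θ₂])
        (by
          intro k
          fin_cases k
          exacts [contMDiff_const, contMDiff_const, contMDiff_const, hT _ (by simp),
            hT _ (by simp), hT _ (by simp)])
        (by intro k; fin_cases k; exacts [C.smooth_β, C.smooth_α, C.smooth_γ, sσ, s0, s0])
        (by intro k; fin_cases k; exacts [s3, s3, s2, s0, s1, s2])
        (by
          intro x v w
          rw [C.d_θ₃_apply x _ _ hvar]
          simp [Fin.sum_univ_six, wedge_apply]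
          ring)
        b (E i b) (E j b) (E k b)
      simp [Fin.sum_univ_six, dFun_const, eσ, e0, e1, e2, e3, eα, eβ, eγ] at h
      simp only [wdd, wd]
      linear_combination h }

end Main

/-! ### Second differentiation, and the scaling of `T₄` -/

section Refined

variable {M P : Type*} [TopologicalSpace M] [ChartedSpace (Eu 3) M]
  [TopologicalSpace P] [ChartedSpace (Eu 5) P] [IsManifold 𝓘(ℝ, Eu 5) ∞ P]
  {Γ : ContactPathGeometry M P} {B : Type*} [TopologicalSpace B]
  [ChartedSpace (Eu 8) B] [MulAction G1 B]
  {R : G1Structure Γ B} {C : CanonicalConnection R}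
  {E : Fin 8 → ∀ b : B, Tan 8 b}

/-- A frame dual to a coframe, as a basis. -/
theorem exists_basis_eq_frame (hE : ∀ b i j, C.coframe i b (E j b) = if i = j then 1 else 0)
    (b : B) : ∃ v : Module.Basis (Fin 8) ℝ (Tan 8 b), ∀ i, v i = E i b := by
  have hli : LinearIndependent ℝ (fun i => E i b) := by
    rw [Fintype.linearIndependent_iff]
    intro g hg i
    have h1 := congrArg (C.coframe i b) hg
    simpa [map_sum, map_smul, hE] using h1
  have hfin : Module.finrank ℝ (Tan 8 b) = 8 := finrank_euclideanSpace_fin (𝕜 := ℝ) (n := 8)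
  exact ⟨basisOfLinearIndependentOfCardEqFinrank hli (by rw [hfin]; rfl), fun i =>
    congrFun (coe_basisOfLinearIndependentOfCardEqFinrank hli _) i⟩

theorem two_form_ext (hE : ∀ b i j, C.coframe i b (E j b) = if i = j then 1 else 0) {b : B}
    {F G : Tan 8 b [⋀^Fin 2]→L[ℝ] ℝ}
    (h : ∀ i j, F ![E i b, E j b] = G ![E i b, E j b]) : F = G := by
  obtain ⟨v, hv⟩ := exists_basis_eq_frame hE b
  apply ContinuousAlternatingMap.toAlternatingMap_injective
  refine Module.Basis.ext_alternating v fun k _ => ?_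
  have hk : (fun i => v (k i)) = ![E (k 0) b, E (k 1) b] := by
    funext i
    fin_cases i <;> exact hv _
  rw [hk]
  exact h _ _

theorem one_form_eq_sum (hE : ∀ b i j, C.coframe i b (E j b) = if i = j then 1 else 0) {b : B}
    (ξ : Tan 8 b →L[ℝ] ℝ) : ξ = ∑ i, ξ (E i b) • C.coframe i b := by
  obtain ⟨v, hv⟩ := exists_basis_eq_frame hE b
  apply ContinuousLinearMap.coe_injective
  refine Module.Basis.ext v fun j => ?_
  rw [hv]
  change ξ (E j b) = (∑ i, ξ (E i b) • C.coframe i b) (E j b)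
  simp [_root_.sum_apply, hE]

theorem dFun_const_mul {n : ℕ} {X : Type*} [TopologicalSpace X] [ChartedSpace (Eu n) X] {f : X → ℝ}
    (hf : ContMDiff 𝓘(ℝ, Eu n) 𝓘(ℝ, ℝ) ∞ f) (c : ℝ) (x : X) (v : Tan n x) :
    dFun (n := n) (fun y => c * f y) x v = c * dFun f x v := by
  have h := ((hf.mdifferentiable (by simp) x).hasMFDerivAt.const_smul c).mfderiv
  exact congrArg (fun L : Eu n →L[ℝ] ℝ => L v) h

theorem CanonicalConnection.smooth_T₁_T₂_T₆_T₇ (C : CanonicalConnection R) :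
    ContMDiff 𝓘(ℝ, Eu 8) 𝓘(ℝ, ℝ) ∞ C.T₁ ∧ ContMDiff 𝓘(ℝ, Eu 8) 𝓘(ℝ, ℝ) ∞ C.T₂ ∧
    ContMDiff 𝓘(ℝ, Eu 8) 𝓘(ℝ, ℝ) ∞ C.T₆ ∧ ContMDiff 𝓘(ℝ, Eu 8) 𝓘(ℝ, ℝ) ∞ C.T₇ :=
  ⟨C.smooth_torsion _ (by simp), C.smooth_torsion _ (by simp), C.smooth_torsion _ (by simp),
    C.smooth_torsion _ (by simp)⟩

theorem G1Structure.contMDiff_smul (R : G1Structure Γ B) (s t : ℝˣ) (c : ℝ) :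
    ContMDiff 𝓘(ℝ, Eu 8) 𝓘(ℝ, Eu 8) ∞ (fun b : B => G1.mk s t c • b) := by
  have h : ContMDiff 𝓘(ℝ, Eu 8) (((𝓘(ℝ, ℝ)).prod ((𝓘(ℝ, ℝ)).prod 𝓘(ℝ, ℝ))).prod 𝓘(ℝ, Eu 8)) ∞
      (fun b : B => (((s, t, c) : ℝˣ × ℝˣ × ℝ), b)) := contMDiff_const.prodMk contMDiff_id
  generalize hf : (fun x : (ℝˣ × ℝˣ × ℝ) × B => G1.mk x.1.1 x.1.2.1 x.1.2.2 • x.2) = f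
  have h2 := R.smooth_action
  rw [hf] at h2
  have h3 := h2.comp h
  rw [← hf] at h3
  exact h3

variable [IsManifold 𝓘(ℝ, Eu 8) ∞ B]

/-- The pointwise relation `T₃_eq` is an identity of functions, so it can be differentiated; this
supplies the hypothesis `h` of the `BianchiData` lemmas. -/
theorem CanonicalConnection.dFun_T₃ (hvar : C.IsVariational)
    (hE : ∀ b i j, C.coframe i b (E j b) = if i = j then 1 else 0) (b : B) (i : Fin 8) :
    (C.bianchiData hvar hE b).t₃ i = -(3 / 5) * (C.bianchiData hvar hE b).t₄ i := by
  have h : C.T₃ = fun b => -(3 / 5) * C.T₄ b :=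
    funext fun b => (C.bianchiData hvar hE b).T₃_eq
  change dFun C.T₃ b (E i b) = _ * dFun C.T₄ b (E i b)
  rw [h, dFun_const_mul (C.smooth_torsion _ (by simp))]

/-- A multiple of `θ₀ ∧ θ₁` plus a multiple of `θ₀ ∧ θ₂` is closed only if it vanishes. -/
theorem CanonicalConnection.eq_zero_of_d_eq (hvar : C.IsVariational)
    (hE : ∀ b i j, C.coframe i b (E j b) = if i = j then 1 else 0) {ξ : OneForm 8 B}
    (hξ : ξ.Smooth) {x y : B → ℝ} (hx : ContMDiff 𝓘(ℝ, Eu 8) 𝓘(ℝ, ℝ) ∞ x)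
    (hy : ContMDiff 𝓘(ℝ, Eu 8) 𝓘(ℝ, ℝ) ∞ y)
    (h : ∀ b, ξ.d b = x b • wedge (R.θ₀ b) (R.θ₁ b) + y b • wedge (R.θ₀ b) (R.θ₂ b)) (b : B) :
    x b = 0 ∧ y b = 0 := by
  have s0 : R.θ₀.Smooth := C.smooth_coframe 1
  have s1 : R.θ₁.Smooth := C.smooth_coframe 2
  have s2 : R.θ₂.Smooth := C.smooth_coframe 3
  have e0 : ∀ b j, R.θ₀ b (E j b) = cof 1 j := fun b => hE b 1
  have e1 : ∀ b j, R.θ₁ b (E j b) = cof 2 j := fun b => hE b 2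
  have e2 : ∀ b j, R.θ₂ b (E j b) = cof 3 j := fun b => hE b 3
  have d0 : ∀ b i j, R.θ₀.d b ![E i b, E j b] = _ := fun b => (C.bianchiData hvar hE b).D₀_eq
  have d1 : ∀ b i j, R.θ₁.d b ![E i b, E j b] = _ := fun b => (C.bianchiData hvar hE b).D₁_eq
  have d2 : ∀ b i j, R.θ₂.d b ![E i b, E j b] = _ := fun b => (C.bianchiData hvar hE b).D₂_eq
  -- The σ ∧ θ₁ ∧ θ₂ component of d(dξ) is y, from the term σ ∧ θ₁ of dθ₀; no derivative of x or y
  -- enters, as those come multiplied by θ₀.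
  have hy0 : ∀ b, y b = 0 := by
    intro b
    have h1 := OneForm.d_d_sum hξ (f := ![x, y]) (a := ![R.θ₀, R.θ₀]) (b := ![R.θ₁, R.θ₂])
      (by intro k; fin_cases k; exacts [hx, hy])
      (by intro k; fin_cases k; exacts [s0, s0])
      (by intro k; fin_cases k; exacts [s1, s2])
      (by
        intro b v w
        rw [h]
        simp [Fin.sum_univ_two, wedge_apply])
      b (E 0 b) (E 2 b) (E 3 b)
    simpa [Fin.sum_univ_two, e0, e1, e2, d0, d1, d2, wd, cof] using h1
  refine ⟨?_, hy0 b⟩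
  -- With y gone everywhere, the σ ∧ θ₀ ∧ θ₂ component is x up to sign, from the term σ ∧ θ₂ of dθ₁.
  have h1 := OneForm.d_d_sum hξ (f := ![x]) (a := ![R.θ₀]) (b := ![R.θ₁])
    (by intro k; fin_cases k; exact hx)
    (by intro k; fin_cases k; exact s0)
    (by intro k; fin_cases k; exact s1)
    (by
      intro b v w
      rw [h]
      simp [hy0, wedge_apply])
    b (E 0 b) (E 1 b) (E 3 b)
  simpa [e0, e1, d0, d1, wd, cof] using h1

/-- The coefficients of `dα - 2/3 dβ` vanish. -/
theorem CanonicalConnection.d_α_coefficients (hvar : C.IsVariational)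
    (hE : ∀ b i j, C.coframe i b (E j b) = if i = j then 1 else 0) (b : B) :
    dFun C.T₁ b (E 0 b) + 2 / 3 * dFun C.T₆ b (E 4 b) = 0 ∧
    C.T₁ b / 2 + dFun C.T₂ b (E 0 b) + 2 / 3 * dFun C.T₇ b (E 4 b) = 0 := by
  obtain ⟨h1, h2, h6, h7⟩ := C.smooth_T₁_T₂_T₆_T₇
  have hs := fun {f : B → ℝ} (hf : ContMDiff 𝓘(ℝ, Eu 8) 𝓘(ℝ, ℝ) ∞ f) j =>
    contMDiff_dFun_frame C.smooth_coframe hE hf j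
  refine C.eq_zero_of_d_eq hvar hE (C.smooth_α.sub_smul C.smooth_β (2 / 3))
    (x := fun b => dFun C.T₁ b (E 0 b) + 2 / 3 * dFun C.T₆ b (E 4 b))
    (y := fun b => C.T₁ b / 2 + dFun C.T₂ b (E 0 b) + 2 / 3 * dFun C.T₇ b (E 4 b))
    ((hs h1 0).add (contMDiff_const.mul (hs h6 4)))
    (((h1.div_const 2).add (hs h2 0)).add (contMDiff_const.mul (hs h7 4))) (fun b => ?_) b
  refine two_form_ext hE fun i j => ?_
  have e0 : ∀ j, R.θ₀ b (E j b) = cof 1 j := hE b 1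
  have e1 : ∀ j, R.θ₁ b (E j b) = cof 2 j := hE b 2
  have e2 : ∀ j, R.θ₂ b (E j b) = cof 3 j := hE b 3
  rw [OneForm.d_sub_smul C.smooth_α C.smooth_β]
  refine ((C.bianchiData hvar hE b).A_sub_B (C.dFun_T₃ hvar hE b) i j).trans ?_
  simp [wedge_apply, e0, e1, e2, wd, bianchiData]

theorem CanonicalConnection.d_α (hvar : C.IsVariational) (b : B) :
    C.α.d b = (2 / 3 : ℝ) • C.β.d b := by
  obtain ⟨E, hE⟩ := C.exists_frame
  obtain ⟨hx, hy⟩ := C.d_α_coefficients hvar hE b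
  refine two_form_ext hE fun i j => ?_
  have h := (C.bianchiData hvar hE b).A_sub_B (C.dFun_T₃ hvar hE b) i j
  simp only [bianchiData, hx, hy] at h
  simp
  linarith

/-- The pullback of σ is s σ, and that of θ₁ ∧ θ₂ is t²/s³ times itself modulo θ₀; the θ₁ ∧ θ₂
components of the pullback of dσ then give s T₄(b) = (t²/s³) T₄(g • b). How α transforms is
irrelevant, since σ vanishes on the vectors used. -/
theorem CanonicalConnection.T₄_smul (hvar : C.IsVariational) (s t : ℝˣ) (c : ℝ) (b : B) :
    C.T₄ (G1.mk s t c • b) = (s : ℝ) ^ 4 / (t : ℝ) ^ 2 * C.T₄ b := by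
  obtain ⟨E, hE⟩ := C.exists_frame
  have hΦ := R.contMDiff_smul s t c
  set Φ : B → B := fun b => G1.mk s t c • b with hΦd
  have heq : ∀ (i : Fin 5) (b : B) (v : Tan 8 b),
      R.canonical i (Φ b) (mfderiv 𝓘(ℝ, Eu 8) 𝓘(ℝ, Eu 8) Φ b v) =
        ∑ j, gMat s t c i j * R.canonical j b v := fun i b v => R.equivariant (G1.mk s t c) b v i
  -- The multiple s σ is written as a difference to fit `OneForm.d_sub_smul`.
  have hσ : R.σ.pullback Φ = fun b => R.σ b - (1 - (s : ℝ)) • R.σ b := by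
    funext b
    ext v
    refine (heq 0 b v).trans ?_
    simp [gMat_eq, Fin.sum_univ_five, G1Structure.σ]
    ring
  have sσ : R.σ.Smooth := C.smooth_coframe 0
  have h1 := OneForm.d_pullback sσ hΦ (by rw [hσ]; exact sσ.sub_smul sσ _) b (E 2 b) (E 3 b)
  rw [hσ, OneForm.d_sub_smul sσ sσ, C.d_σ_apply _ _ _ hvar, C.d_σ_apply _ _ _ hvar] at h1
  have q0 := fun j => heq 0 b (E j b)
  have q1 := fun j => heq 1 b (E j b)
  have q2 := fun j => heq 2 b (E j b)
  have q3 := fun j => heq 3 b (E j b)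
  have e0 : ∀ j, R.canonical 0 b (E j b) = cof 0 j := hE b 0
  have e1 : ∀ j, R.canonical 1 b (E j b) = cof 1 j := hE b 1
  have e2 : ∀ j, R.canonical 2 b (E j b) = cof 2 j := hE b 2
  have e3 : ∀ j, R.canonical 3 b (E j b) = cof 3 j := hE b 3
  have e4 : ∀ j, R.canonical 4 b (E j b) = cof 4 j := hE b 4
  simp only [Fin.sum_univ_five, e0, e1, e2, e3, e4] at q0 q1 q2 q3
  simp only [wedge_apply, G1Structure.σ, G1Structure.θ₀, G1Structure.θ₁, G1Structure.θ₂,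
    e0, e1, e2, e3, q0, q1, q2, q3] at h1
  simp [gMat_eq, cof] at h1
  have hs := s.ne_zero
  have ht := t.ne_zero
  field_simp at h1 ⊢
  linarith

end Refined

/-! ### Congruences modulo the θᵢ, and the refined structure equations -/

section Conclusion

variable {M P : Type*} [TopologicalSpace M] [ChartedSpace (Eu 3) M]
  [TopologicalSpace P] [ChartedSpace (Eu 5) P] [IsManifold 𝓘(ℝ, Eu 5) ∞ P]
  {Γ : ContactPathGeometry M P} {B : Type*} [TopologicalSpace B]
  [ChartedSpace (Eu 8) B] [MulAction G1 B]
  {R : G1Structure Γ B} {C : CanonicalConnection R}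
  {E : Fin 8 → ∀ b : B, Tan 8 b}

theorem mem_span_θ (hE : ∀ b i j, C.coframe i b (E j b) = if i = j then 1 else 0) {b : B}
    {ξ : Tan 8 b →L[ℝ] ℝ} (h0 : ξ (E 0 b) = 0) (h5 : ξ (E 5 b) = 0) (h6 : ξ (E 6 b) = 0)
    (h7 : ξ (E 7 b) = 0) : ξ ∈ Submodule.span ℝ {R.θ₀ b, R.θ₁ b, R.θ₂ b, R.θ₃ b} := by
  rw [one_form_eq_sum hE ξ, Fin.sum_univ_eight, h0, h5, h6, h7]
  simp only [zero_smul, zero_add, add_zero]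
  refine Submodule.add_mem _ (Submodule.add_mem _ (Submodule.add_mem _ ?_ ?_) ?_) ?_ <;>
    exact Submodule.smul_mem _ _ (Submodule.subset_span (by simp [CanonicalConnection.coframe]))

theorem mem_span_θ' (hE : ∀ b i j, C.coframe i b (E j b) = if i = j then 1 else 0) {b : B}
    {ξ : Tan 8 b →L[ℝ] ℝ} (h0 : ξ (E 0 b) = 0) (h4 : ξ (E 4 b) = 0) (h5 : ξ (E 5 b) = 0)
    (h6 : ξ (E 6 b) = 0) (h7 : ξ (E 7 b) = 0) :
    ξ ∈ Submodule.span ℝ {R.θ₀ b, R.θ₁ b, R.θ₂ b} := by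
  rw [one_form_eq_sum hE ξ, Fin.sum_univ_eight, h0, h4, h5, h6, h7]
  simp only [zero_smul, zero_add, add_zero]
  refine Submodule.add_mem _ (Submodule.add_mem _ ?_ ?_) ?_ <;>
    exact Submodule.smul_mem _ _ (Submodule.subset_span (by simp [CanonicalConnection.coframe]))

end Conclusion

end PathGeom

end

theorem mainTheorem3
    {M : Type*} [TopologicalSpace M] [ChartedSpace (PathGeom.Eu 3) M]
    [IsManifold 𝓘(ℝ, PathGeom.Eu 3) ∞ M]
    {P : Type*} [TopologicalSpace P] [ChartedSpace (PathGeom.Eu 5) P]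
    [IsManifold 𝓘(ℝ, PathGeom.Eu 5) ∞ P]
    {B : Type*} [TopologicalSpace B] [ChartedSpace (PathGeom.Eu 8) B]
    [IsManifold 𝓘(ℝ, PathGeom.Eu 8) ∞ B] [MulAction PathGeom.G1 B]
    (Γ : PathGeom.ContactPathGeometry M P)
    (R : PathGeom.G1Structure Γ B)
    (C : PathGeom.CanonicalConnection R)
    (hvar : C.IsVariational) :
    (∃ U₁ U₂ : B → ℝ,
      ContMDiff 𝓘(ℝ, PathGeom.Eu 8) 𝓘(ℝ, ℝ) ∞ U₁ ∧
      ContMDiff 𝓘(ℝ, PathGeom.Eu 8) 𝓘(ℝ, ℝ) ∞ U₂ ∧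
      -- the derivatives of the connection forms
      (∀ b, C.α.d b = (2 / 3 : ℝ) • C.β.d b) ∧
      (∀ b, C.β.d b = PathGeom.wedge (R.σ b) (C.γ b) - PathGeom.wedge (C.τ b) (R.θ₁ b)
        - (3 : ℝ) • PathGeom.wedge (C.ν U₁ U₂ b) (R.θ₀ b)) ∧
      (∀ b, ∃ μ : PathGeom.Tan 8 b →L[ℝ] ℝ,
        C.γ.d b = PathGeom.wedge (C.γ b) (C.α b) - PathGeom.wedge (C.τ b) (R.θ₂ b)
          - PathGeom.wedge (C.ν U₁ U₂ b) (R.θ₁ b) + PathGeom.wedge μ (R.θ₀ b)) ∧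
      -- the derivatives of the torsion components
      (∀ b, PathGeom.dFun C.T₁ b - (C.T₁ b • ((2 : ℝ) • C.α b - (2 : ℝ) • C.β b)
          - (4 / 3 * C.T₂ b) • C.γ b - (2 * U₁ b) • R.σ b) ∈
        Submodule.span ℝ {R.θ₀ b, R.θ₁ b, R.θ₂ b, R.θ₃ b}) ∧
      (∀ b, PathGeom.dFun C.T₂ b - (C.T₂ b • ((3 : ℝ) • C.α b - (2 : ℝ) • C.β b)
          - (2 / 5 * C.T₄ b) • C.γ b - (C.T₁ b + 2 * U₂ b) • R.σ b) ∈
        Submodule.span ℝ {R.θ₀ b, R.θ₁ b, R.θ₂ b, R.θ₃ b})) ∧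
    (∀ b, C.T₃ b = -(3 / 5) * C.T₄ b) ∧
    (∀ b, PathGeom.dFun C.T₄ b - (C.T₄ b • ((4 : ℝ) • C.α b - (2 : ℝ) • C.β b)
        - (5 / 3 * C.T₂ b) • R.σ b) ∈
      Submodule.span ℝ {R.θ₀ b, R.θ₁ b, R.θ₂ b}) ∧
    -- `T₄` varies along the fibres only by scaling
    (∀ (s t : ℝˣ) (c : ℝ) (b : B),
      C.T₄ (PathGeom.G1.mk s t c • b) = (s : ℝ) ^ 4 / (t : ℝ) ^ 2 * C.T₄ b) := by
  obtain ⟨E, hE⟩ := C.exists_frame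
  have hE0 : ∀ b j, R.σ b (E j b) = PathGeom.cof 0 j := fun b => hE b 0
  have hE1 : ∀ b j, R.θ₀ b (E j b) = PathGeom.cof 1 j := fun b => hE b 1
  have hE2 : ∀ b j, R.θ₁ b (E j b) = PathGeom.cof 2 j := fun b => hE b 2
  have hE3 : ∀ b j, R.θ₂ b (E j b) = PathGeom.cof 3 j := fun b => hE b 3
  have hE4 : ∀ b j, R.θ₃ b (E j b) = PathGeom.cof 4 j := fun b => hE b 4
  have hE5 : ∀ b j, C.α b (E j b) = PathGeom.cof 5 j := fun b => hE b 5
  have hE6 : ∀ b j, C.β b (E j b) = PathGeom.cof 6 j := fun b => hE b 6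
  have hE7 : ∀ b j, C.γ b (E j b) = PathGeom.cof 7 j := fun b => hE b 7
  obtain ⟨s1, s2, -, -⟩ := C.smooth_T₁_T₂_T₆_T₇
  have hs := fun {f : B → ℝ} (hf : ContMDiff 𝓘(ℝ, PathGeom.Eu 8) 𝓘(ℝ, ℝ) ∞ f) =>
    PathGeom.contMDiff_dFun_frame C.smooth_coframe hE hf 0
  let Q := C.bianchiData hvar hE
  have hdα := C.d_α hvar
  have hAB : ∀ b i j, (Q b).A i j = 2 / 3 * (Q b).B i j := fun b i j =>
    congrArg (fun F => F ![E i b, E j b]) (hdα b)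
  have h3 := C.dFun_T₃ hvar hE
  -- The choice is forced: the σ-components of dT₁ and dT₂ must be -2U₁ and -(T₁ + 2U₂).
  let U₁ : B → ℝ := fun b => -1 / 2 * PathGeom.dFun C.T₁ b (E 0 b)
  let U₂ : B → ℝ := fun b => -1 / 2 * (C.T₁ b + PathGeom.dFun C.T₂ b (E 0 b))
  have hU₁ : ∀ b, (Q b).t₁ 0 = -2 * U₁ b := fun b => by
    change PathGeom.dFun C.T₁ b (E 0 b) = -2 * (-1 / 2 * _)
    ring
  have hU₂ : ∀ b, (Q b).t₂ 0 = -((Q b).T₁ + 2 * U₂ b) := fun b => by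
    change PathGeom.dFun C.T₂ b (E 0 b) = -(C.T₁ b + 2 * (-1 / 2 * _))
    ring
  refine ⟨⟨U₁, U₂, contMDiff_const.mul (hs s1), contMDiff_const.mul (s1.add (hs s2)), hdα,
    fun b => ?_, fun b => ?_, fun b => ?_, fun b => ?_⟩, fun b => (Q b).T₃_eq, fun b => ?_,
    C.T₄_smul hvar⟩
  · refine PathGeom.two_form_ext hE fun i j => ?_
    refine ((Q b).B_formula (h3 b) (hAB b) (hU₁ b) (hU₂ b) i j).trans ?_
    simp [PathGeom.wedge_apply, PathGeom.CanonicalConnection.τ, PathGeom.CanonicalConnection.ν,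
      hE0, hE1, hE2, hE3, hE4, hE7, PathGeom.wd, Q, PathGeom.CanonicalConnection.bianchiData]
    ring
  -- These are the components of the covector μ, chosen so that μ ∧ θ₀ corrects the θ₀-row of dγ.
  · let m : Fin 8 → ℝ := fun k =>
      PathGeom.wd (PathGeom.cof 7) (PathGeom.cof 5) 1 k - (Q b).G 1 k
    have hm : ∀ i, (∑ k, m k • C.coframe k b) (E i b) = m i := fun i => by
      simp [_root_.sum_apply, hE]
    refine ⟨∑ k, m k • C.coframe k b, PathGeom.two_form_ext hE fun i j => ?_⟩
    refine ((Q b).G_formula (h3 b) (hAB b) (hU₁ b) (hU₂ b) i j).trans ?_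
    change _ + PathGeom.wd m (PathGeom.cof 1) i j = _
    simp only [ContinuousAlternatingMap.add_apply, ContinuousAlternatingMap.sub_apply,
      PathGeom.wedge_apply, hm]
    simp [PathGeom.CanonicalConnection.τ, PathGeom.CanonicalConnection.ν,
      hE0, hE1, hE2, hE3, hE4, hE5, hE7, PathGeom.wd, Q, PathGeom.CanonicalConnection.bianchiData]
    ring
  · obtain ⟨q5, q6, q7⟩ := (Q b).t₁_vertical
    have q0 := hU₁ b
    refine PathGeom.mem_span_θ hE ?_ ?_ ?_ ?_ <;>
      simp [hE0, hE5, hE6, hE7, PathGeom.cof, Q, PathGeom.CanonicalConnection.bianchiData] at * <;>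
      linarith
  · obtain ⟨q5, q6, q7⟩ := (Q b).t₂_vertical
    have q0 := hU₂ b
    refine PathGeom.mem_span_θ hE ?_ ?_ ?_ ?_ <;>
      simp [hE0, hE5, hE6, hE7, PathGeom.cof, Q, PathGeom.CanonicalConnection.bianchiData] at * <;>
      linarith
  · obtain ⟨q4, q5, q6, q7⟩ := (Q b).t₄_vertical
    have q0 := (Q b).t₄_σ (h3 b)
    refine PathGeom.mem_span_θ' hE ?_ ?_ ?_ ?_ ?_ <;>
      simp [hE0, hE5, hE6, hE7, PathGeom.cof, Q, PathGeom.CanonicalConnection.bianchiData] at * <;>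
      linarith
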